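/- Let $d\ge 1$ and let $H_1,\dots,H_d,K_1,\dots,K_d$ be finite dimensional Hilbert spaces over the same field of scalars ($\mathbb R$ or $\mathbb C$). Let $\otimes_2$ denote the Hilbert space tensor product, and $\check\otimes$ the injective tensor product of finite dimensional normed spaces, i.e. the algebraic tensor product $E_1\otimes\cdots\otimes E_m$ with the norm $$\|t\|=\sup\{|(f_1\otimes\cdots\otimes f_m)(t)| : f_j\in E_j^*,\ \|f_j\|\le 1\}.$$ Let $$J:(H_1\otimes_2K_1)\check\otimes\cdots\check\otimes(H_d\otimes_2K_d)\to(H_1\otimes_2\cdots\otimes_2H_d)\check\otimes(K_1\otimes_2\cdots\otimes_2K_d)$$ be the natural identification map, i.e. the linear map with $J\big((x_1\otimes y_1)\otimes\cdots\otimes(x_d\otimes y_d)\big)=(x_1\otimes\cdots\otimes x_d)\otimes(y_1\otimes\cdots\otimes y_d)$, and let $\|J\|$ be its operator norm. (i) For every $j_0\in\{1,\dots,d\}$, $$\|J\|\le\prod_{j\ne j_0}\big(\dim(H_j)\dim(K_j)\big)^{1/2}.$$ In particular $\|J\|\le\prod_{j=1}^{d-1}(\dim(H_j)\dim(K_j))^{1/2}$;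 the best of these bounds is the one where $j_0$ maximizes $\dim(H_j)\dim(K_j)$. (ii) There is a constant $c''>0$, depending only on $d$ (and the field of scalars), such that for every integer $N\ge 2$, if $\dim(H_j)=\dim(K_j)=N$ for all $j$, then $$c''\,N^{d-1}(\log N)^{-d/2}\le\|J\|\le N^{d-1},$$ so the upper bound is sharp up to the logarithmic factor. -/

import Mathlib

open scoped TensorProduct

universe u v w

noncomputable section

namespace TensorNorms

variable {𝕜 : Type*} [RCLike 𝕜]

/-! ### The Hilbert space tensor product of finitely many finite dimensional Hilbert spaces -/

section Hilbert

variable {ι : Type*} [Fintype ι]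

/-- The Hilbertian tensor product `H₁ ⊗₂ ⋯ ⊗₂ H_d` of finite dimensional Hilbert spaces: the
algebraic tensor product, with the inner product for which
`⟪x₁ ⊗ ⋯ ⊗ x_d, y₁ ⊗ ⋯ ⊗ y_d⟫ = ∏ j, ⟪x_j, y_j⟫` (see `HilbertTensor.inner_tprod`). It is a type
synonym because the algebraic tensor product already carries another norm in Mathlib. -/
def HilbertTensor (𝕜 : Type*) [RCLike 𝕜] {ι : Type*} (H : ι → Type*)
    [∀ j, NormedAddCommGroup (H j)] [∀ j, InnerProductSpace 𝕜 (H j)] : Type _ :=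
  ⨂[𝕜] j, H j

namespace HilbertTensor

variable (H : ι → Type*) [∀ j, NormedAddCommGroup (H j)] [∀ j, InnerProductSpace 𝕜 (H j)]

instance : AddCommGroup (HilbertTensor 𝕜 H) := inferInstanceAs (AddCommGroup (⨂[𝕜] j, H j))

instance : Module 𝕜 (HilbertTensor 𝕜 H) := inferInstanceAs (Module 𝕜 (⨂[𝕜] j, H j))

variable (𝕜) in
/-- The identity, as a linear equivalence with the algebraic tensor product. -/
def equiv : HilbertTensor 𝕜 H ≃ₗ[𝕜] ⨂[𝕜] j, H j := LinearEquiv.refl 𝕜 _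

variable {H} in
variable (𝕜) in
/-- The elementary tensor `x₁ ⊗ ⋯ ⊗ x_d`. -/
def tprod (x : ∀ j, H j) : HilbertTensor 𝕜 H := (equiv 𝕜 H).symm (PiTensorProduct.tprod 𝕜 x)

variable [∀ j, FiniteDimensional 𝕜 (H j)]

instance : FiniteDimensional 𝕜 (HilbertTensor 𝕜 H) :=
  inferInstanceAs (Module.Finite 𝕜 (⨂[𝕜] j, H j))

variable (𝕜) in
/-- Coordinates with respect to the tensor products of vectors of orthonormal bases. -/
def coords : HilbertTensor 𝕜 H ≃ₗ[𝕜]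
    EuclideanSpace 𝕜 (∀ j, Fin (Module.finrank 𝕜 (H j))) :=
  (equiv 𝕜 H).trans <|
    (Basis.piTensorProduct fun j => (stdOrthonormalBasis 𝕜 (H j)).toBasis).equivFun.trans
      (WithLp.linearEquiv 2 𝕜 _).symm

open scoped Classical in
/-- The inner product that makes the tensor products of orthonormal basis vectors orthonormal. -/
abbrev core : InnerProductSpace.Core 𝕜 (HilbertTensor 𝕜 H) where
  inner x y := inner 𝕜 (coords 𝕜 H x) (coords 𝕜 H y)
  conj_inner_symm x y := inner_conj_symm _ _
  re_inner_nonneg x := inner_self_nonneg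
  add_left x y z := by rw [map_add, inner_add_left]
  smul_left x y r := by rw [map_smul, inner_smul_left]
  definite x hx := by
    rw [inner_self_eq_zero] at hx
    exact (coords 𝕜 H).map_eq_zero_iff.mp hx

instance : NormedAddCommGroup (HilbertTensor 𝕜 H) :=
  (core (𝕜 := 𝕜) H).toNormedAddCommGroup

instance : InnerProductSpace 𝕜 (HilbertTensor 𝕜 H) := .ofCore (core H).toCore

open scoped Classical in
theorem inner_def (x y : HilbertTensor 𝕜 H) :
    inner 𝕜 x y = inner 𝕜 (coords 𝕜 H x) (coords 𝕜 H y) := rfl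

/-- The inner product is the usual one on elementary tensors; in particular it does not depend on
the orthonormal bases used to define it. -/
theorem inner_tprod (x y : ∀ j, H j) :
    inner 𝕜 (tprod 𝕜 x) (tprod 𝕜 y) = ∏ j, inner 𝕜 (x j) (y j) := by
  classical
  have h (x : ∀ j, H j) (p) :
      coords 𝕜 H (tprod 𝕜 x) p = ∏ j, (stdOrthonormalBasis 𝕜 (H j)).repr (x j) (p j) := by
    simp [coords, tprod]
  rw [inner_def, PiLp.inner_apply]
  simp only [h]
  calc _ = ∏ j, ∑ i, inner 𝕜 ((stdOrthonormalBasis 𝕜 (H j)).repr (x j) i)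
        ((stdOrthonormalBasis 𝕜 (H j)).repr (y j) i) := by
        rw [Finset.prod_univ_sum, Fintype.piFinset_univ]
        simp [Finset.prod_mul_distrib]
    _ = _ := by
        refine Finset.prod_congr rfl fun j _ => ?_
        rw [← PiLp.inner_apply, LinearIsometryEquiv.inner_map_map]

end HilbertTensor

end Hilbert

/-! ### The injective tensor product of finitely many finite dimensional normed spaces -/

section Injective

variable {ι : Type*} [Fintype ι]

/-- The functional `f₁ ⊗ ⋯ ⊗ f_d`, `x₁ ⊗ ⋯ ⊗ x_d ↦ f₁ x₁ ⋯ f_d x_d`. -/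
def tensorFunctional {E : ι → Type*} [∀ j, NormedAddCommGroup (E j)] [∀ j, NormedSpace 𝕜 (E j)]
    (f : ∀ j, E j →L[𝕜] 𝕜) : (⨂[𝕜] j, E j) →ₗ[𝕜] 𝕜 :=
  PiTensorProduct.lift
    ((MultilinearMap.mkPiAlgebra 𝕜 ι 𝕜).compLinearMap fun j => (f j : E j →ₗ[𝕜] 𝕜))

@[simp]
theorem tensorFunctional_tprod {E : ι → Type*} [∀ j, NormedAddCommGroup (E j)]
    [∀ j, NormedSpace 𝕜 (E j)] (f : ∀ j, E j →L[𝕜] 𝕜) (x : ∀ j, E j) :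
    tensorFunctional f (PiTensorProduct.tprod 𝕜 x) = ∏ j, f j (x j) := by
  simp [tensorFunctional]

/-- The injective tensor product `E₁ ⊗̌ ⋯ ⊗̌ E_d` of finite dimensional normed spaces: the algebraic
tensor product, with the norm
`‖t‖ = sup {|(f₁ ⊗ ⋯ ⊗ f_d) t| : f_j in the closed unit ball of the dual of E_j}`. -/
def InjectiveTensor (𝕜 : Type*) [RCLike 𝕜] {ι : Type*} (E : ι → Type*)
    [∀ j, NormedAddCommGroup (E j)] [∀ j, NormedSpace 𝕜 (E j)] : Type _ :=
  ⨂[𝕜] j, E j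

namespace InjectiveTensor

variable (E : ι → Type*) [∀ j, NormedAddCommGroup (E j)] [∀ j, NormedSpace 𝕜 (E j)]

instance : AddCommGroup (InjectiveTensor 𝕜 E) := inferInstanceAs (AddCommGroup (⨂[𝕜] j, E j))

instance : Module 𝕜 (InjectiveTensor 𝕜 E) := inferInstanceAs (Module 𝕜 (⨂[𝕜] j, E j))

variable (𝕜) in
/-- The identity, as a linear equivalence with the algebraic tensor product. -/
def equiv : InjectiveTensor 𝕜 E ≃ₗ[𝕜] ⨂[𝕜] j, E j := LinearEquiv.refl 𝕜 _

variable (𝕜) in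
/-- Families of functionals, all of norm at most one. -/
abbrev DualBall : Type _ := {f : ∀ j, E j →L[𝕜] 𝕜 // ∀ j, ‖f j‖ ≤ 1}

instance : Nonempty (DualBall 𝕜 E) := ⟨⟨fun _ => 0, fun _ => by simp⟩⟩

instance : Norm (InjectiveTensor 𝕜 E) where
  norm t := ⨆ f : DualBall 𝕜 E, ‖tensorFunctional f.1 (equiv 𝕜 E t)‖

theorem norm_def (t : InjectiveTensor 𝕜 E) :
    ‖t‖ = ⨆ f : DualBall 𝕜 E, ‖tensorFunctional f.1 (equiv 𝕜 E t)‖ := rfl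

theorem bddAbove (t : ⨂[𝕜] j, E j) :
    BddAbove (Set.range fun f : DualBall 𝕜 E => ‖tensorFunctional f.1 t‖) := by
  induction t using PiTensorProduct.induction_on with
  | smul_tprod r x =>
    refine ⟨‖r‖ * ∏ j, ‖x j‖, ?_⟩
    rintro _ ⟨f, rfl⟩
    simp only [map_smul, tensorFunctional_tprod, norm_smul, norm_prod]
    gcongr with j
    exact (f.1 j).le_of_opNorm_le (f.2 j) (x j) |>.trans_eq (one_mul _)
  | add s t hs ht =>
    obtain ⟨a, ha⟩ := hs
    obtain ⟨b, hb⟩ := ht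
    refine ⟨a + b, ?_⟩
    rintro _ ⟨f, rfl⟩
    simp only [map_add]
    exact (norm_add_le _ _).trans (add_le_add (ha ⟨f, rfl⟩) (hb ⟨f, rfl⟩))

theorem le_norm (t : InjectiveTensor 𝕜 E) (f : DualBall 𝕜 E) :
    ‖tensorFunctional f.1 (equiv 𝕜 E t)‖ ≤ ‖t‖ :=
  le_ciSup (bddAbove E (equiv 𝕜 E t)) f

variable [∀ j, FiniteDimensional 𝕜 (E j)]

instance : FiniteDimensional 𝕜 (InjectiveTensor 𝕜 E) :=
  inferInstanceAs (Module.Finite 𝕜 (⨂[𝕜] j, E j))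

theorem eq_zero_of_norm_eq_zero (t : InjectiveTensor 𝕜 E) (ht : ‖t‖ = 0) : t = 0 := by
  classical
  let b := fun j => Module.finBasis 𝕜 (E j)
  refine (equiv 𝕜 E).map_eq_zero_iff.mp ((Basis.piTensorProduct b).ext_elem fun p => ?_)
  let c : ∀ j, E j →L[𝕜] 𝕜 := fun j => LinearMap.toContinuousLinearMap ((b j).coord (p j))
  let a : ι → 𝕜 := fun j => ((‖c j‖ + 1 : ℝ) : 𝕜)
  have ha (j) : a j ≠ 0 := by
    have : (0 : ℝ) < ‖c j‖ + 1 := by positivity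
    simpa only [a, ne_eq, RCLike.ofReal_eq_zero] using this.ne'
  let f : DualBall 𝕜 E := ⟨fun j => (a j)⁻¹ • c j, fun j => by
    have : (0 : ℝ) < ‖c j‖ + 1 := by positivity
    rw [norm_smul, norm_inv, RCLike.norm_ofReal, abs_of_pos this, inv_mul_le_one₀ this]
    linarith⟩
  have h0 : tensorFunctional f.1 (equiv 𝕜 E t) = 0 := by
    have := le_norm E t f
    rw [ht] at this
    exact norm_le_zero_iff.mp this
  have hrepr : (∏ j, a j) • tensorFunctional f.1 = (Basis.piTensorProduct b).coord p := by
    refine PiTensorProduct.ext (MultilinearMap.ext fun x => ?_)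
    simp only [LinearMap.compMultilinearMap_apply, LinearMap.smul_apply, tensorFunctional_tprod,
      Module.Basis.coord_apply, Basis.piTensorProduct_repr_tprod_apply, smul_eq_mul,
      ← Finset.prod_mul_distrib]
    refine Finset.prod_congr rfl fun j _ => ?_
    simp [f, c, ha j]
  have := LinearMap.congr_fun hrepr (equiv 𝕜 E t)
  rw [LinearMap.smul_apply, h0, smul_zero] at this
  simpa using this.symm

theorem normedSpaceCore : NormedSpace.Core 𝕜 (InjectiveTensor 𝕜 E) where
  norm_nonneg t := Real.iSup_nonneg fun _ => norm_nonneg _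
  norm_smul r t := by
    simp only [norm_def, map_smul, norm_smul]
    exact (Real.mul_iSup_of_nonneg (norm_nonneg r) _).symm
  norm_triangle s t := by
    refine ciSup_le fun f => ?_
    rw [map_add, map_add]
    exact (norm_add_le _ _).trans (add_le_add (le_norm E s f) (le_norm E t f))
  norm_eq_zero_iff t := ⟨eq_zero_of_norm_eq_zero E t, by rintro rfl; simp [norm_def]⟩

instance : NormedAddCommGroup (InjectiveTensor 𝕜 E) := .ofCore (normedSpaceCore (𝕜 := 𝕜) E)

instance : NormedSpace 𝕜 (InjectiveTensor 𝕜 E) := .ofCore (normedSpaceCore (𝕜 := 𝕜) E)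

end InjectiveTensor

end Injective

/-! ### The injective tensor product of two finite dimensional normed spaces -/

section Injective₂

/-- The injective tensor product `E ⊗̌ F` of two finite dimensional normed spaces: the algebraic
tensor product, with the norm
`‖t‖ = sup {|(f ⊗ g) t| : f, g in the closed unit balls of the duals of E and F}`. -/
def InjectiveTensor₂ (𝕜 : Type*) [RCLike 𝕜] (E F : Type*) [NormedAddCommGroup E] [NormedSpace 𝕜 E]
    [NormedAddCommGroup F] [NormedSpace 𝕜 F] : Type _ :=
  E ⊗[𝕜] F

namespace InjectiveTensor₂

variable (E F : Type*) [NormedAddCommGroup E] [NormedSpace 𝕜 E]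
  [NormedAddCommGroup F] [NormedSpace 𝕜 F]

instance : AddCommGroup (InjectiveTensor₂ 𝕜 E F) := inferInstanceAs (AddCommGroup (E ⊗[𝕜] F))

instance : Module 𝕜 (InjectiveTensor₂ 𝕜 E F) := inferInstanceAs (Module 𝕜 (E ⊗[𝕜] F))

variable (𝕜) in
/-- The identity, as a linear equivalence with the algebraic tensor product. -/
def equiv : InjectiveTensor₂ 𝕜 E F ≃ₗ[𝕜] E ⊗[𝕜] F := LinearEquiv.refl 𝕜 _

variable {E F} in
/-- The functional `f ⊗ g`, `x ⊗ y ↦ f x * g y`. -/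
def functional (f : E →L[𝕜] 𝕜) (g : F →L[𝕜] 𝕜) : E ⊗[𝕜] F →ₗ[𝕜] 𝕜 :=
  LinearMap.mul' 𝕜 𝕜 ∘ₗ TensorProduct.map (f : E →ₗ[𝕜] 𝕜) (g : F →ₗ[𝕜] 𝕜)

@[simp]
theorem functional_tmul (f : E →L[𝕜] 𝕜) (g : F →L[𝕜] 𝕜) (x : E) (y : F) :
    functional f g (x ⊗ₜ[𝕜] y) = f x * g y := by
  simp [functional]

variable (𝕜) in
/-- Pairs of functionals, both of norm at most one. -/
abbrev DualBall : Type _ := {f : (E →L[𝕜] 𝕜) × (F →L[𝕜] 𝕜) // ‖f.1‖ ≤ 1 ∧ ‖f.2‖ ≤ 1}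

instance : Nonempty (DualBall 𝕜 E F) := ⟨⟨(0, 0), by simp⟩⟩

instance : Norm (InjectiveTensor₂ 𝕜 E F) where
  norm t := ⨆ f : DualBall 𝕜 E F, ‖functional f.1.1 f.1.2 (equiv 𝕜 E F t)‖

theorem norm_def (t : InjectiveTensor₂ 𝕜 E F) :
    ‖t‖ = ⨆ f : DualBall 𝕜 E F, ‖functional f.1.1 f.1.2 (equiv 𝕜 E F t)‖ := rfl

theorem bddAbove (t : E ⊗[𝕜] F) :
    BddAbove (Set.range fun f : DualBall 𝕜 E F => ‖functional f.1.1 f.1.2 t‖) := by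
  induction t using TensorProduct.induction_on with
  | zero => exact ⟨0, by rintro _ ⟨f, rfl⟩; simp⟩
  | tmul x y =>
    refine ⟨‖x‖ * ‖y‖, ?_⟩
    rintro _ ⟨f, rfl⟩
    simp only [functional_tmul, norm_mul]
    gcongr
    · exact f.1.1.le_of_opNorm_le f.2.1 x |>.trans_eq (one_mul _)
    · exact f.1.2.le_of_opNorm_le f.2.2 y |>.trans_eq (one_mul _)
  | add s t hs ht =>
    obtain ⟨a, ha⟩ := hs
    obtain ⟨b, hb⟩ := ht
    refine ⟨a + b, ?_⟩
    rintro _ ⟨f, rfl⟩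
    simp only [map_add]
    exact (norm_add_le _ _).trans (add_le_add (ha ⟨f, rfl⟩) (hb ⟨f, rfl⟩))

theorem le_norm (t : InjectiveTensor₂ 𝕜 E F) (f : DualBall 𝕜 E F) :
    ‖functional f.1.1 f.1.2 (equiv 𝕜 E F t)‖ ≤ ‖t‖ :=
  le_ciSup (bddAbove E F (equiv 𝕜 E F t)) f

variable [FiniteDimensional 𝕜 E] [FiniteDimensional 𝕜 F]

instance : FiniteDimensional 𝕜 (InjectiveTensor₂ 𝕜 E F) :=
  inferInstanceAs (Module.Finite 𝕜 (E ⊗[𝕜] F))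

theorem eq_zero_of_norm_eq_zero (t : InjectiveTensor₂ 𝕜 E F) (ht : ‖t‖ = 0) : t = 0 := by
  classical
  let b := Module.finBasis 𝕜 E
  let b' := Module.finBasis 𝕜 F
  refine (equiv 𝕜 E F).map_eq_zero_iff.mp ((b.tensorProduct b').ext_elem fun p => ?_)
  let c : E →L[𝕜] 𝕜 := LinearMap.toContinuousLinearMap (b.coord p.1)
  let c' : F →L[𝕜] 𝕜 := LinearMap.toContinuousLinearMap (b'.coord p.2)
  have h (r : ℝ) (hr : 0 ≤ r) : ((r + 1 : ℝ) : 𝕜) ≠ 0 := by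
    have : (0 : ℝ) < r + 1 := by positivity
    simpa only [ne_eq, RCLike.ofReal_eq_zero] using this.ne'
  have h1 (r : ℝ) (hr : 0 ≤ r) : ‖(((r + 1 : ℝ) : 𝕜))⁻¹‖ * r ≤ 1 := by
    have : (0 : ℝ) < r + 1 := by positivity
    rw [norm_inv, RCLike.norm_ofReal, abs_of_pos this, inv_mul_le_one₀ this]
    linarith
  let f : DualBall 𝕜 E F := ⟨(((‖c‖ + 1 : ℝ) : 𝕜)⁻¹ • c, ((‖c'‖ + 1 : ℝ) : 𝕜)⁻¹ • c'), by
    simp only [norm_smul]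
    exact ⟨h1 _ (norm_nonneg c), h1 _ (norm_nonneg c')⟩⟩
  have h0 : functional f.1.1 f.1.2 (equiv 𝕜 E F t) = 0 := by
    have := le_norm E F t f
    rw [ht] at this
    exact norm_le_zero_iff.mp this
  have hrepr : (((‖c‖ + 1 : ℝ) : 𝕜) * ((‖c'‖ + 1 : ℝ) : 𝕜)) • functional f.1.1 f.1.2 =
      (b.tensorProduct b').coord p := by
    refine TensorProduct.ext' fun x y => ?_
    have e : (b.tensorProduct b').coord p (x ⊗ₜ[𝕜] y) = c x * c' y := by
      obtain ⟨i, j⟩ := p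
      simp [c, c', mul_comm]
    rw [e]
    simp only [LinearMap.smul_apply, functional_tmul, smul_eq_mul, f,
      _root_.smul_apply]
    have := h _ (norm_nonneg c)
    have := h _ (norm_nonneg c')
    field_simp
  have := LinearMap.congr_fun hrepr (equiv 𝕜 E F t)
  rw [LinearMap.smul_apply, h0, smul_zero] at this
  simpa using this.symm

theorem normedSpaceCore : NormedSpace.Core 𝕜 (InjectiveTensor₂ 𝕜 E F) where
  norm_nonneg t := Real.iSup_nonneg fun _ => norm_nonneg _
  norm_smul r t := by
    simp only [norm_def, map_smul, norm_smul]
    exact (Real.mul_iSup_of_nonneg (norm_nonneg r) _).symm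
  norm_triangle s t := by
    refine ciSup_le fun f => ?_
    rw [map_add, map_add]
    exact (norm_add_le _ _).trans (add_le_add (le_norm E F s f) (le_norm E F t f))
  norm_eq_zero_iff t := ⟨eq_zero_of_norm_eq_zero E F t, by rintro rfl; simp [norm_def]⟩

instance : NormedAddCommGroup (InjectiveTensor₂ 𝕜 E F) := .ofCore (normedSpaceCore (𝕜 := 𝕜) E F)

instance : NormedSpace 𝕜 (InjectiveTensor₂ 𝕜 E F) := .ofCore (normedSpaceCore (𝕜 := 𝕜) E F)

end InjectiveTensor₂

end Injective₂

/-! ### The natural identification -/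

section Identification

variable {ι : Type*} (H K : ι → Type*)
  [∀ j, NormedAddCommGroup (H j)] [∀ j, InnerProductSpace 𝕜 (H j)]
  [∀ j, NormedAddCommGroup (K j)] [∀ j, InnerProductSpace 𝕜 (K j)]

variable (𝕜) in
/-- The linear map `(⨂ H_j) ⊗ (⨂ K_j) → ⨂ (H_j ⊗ K_j)` with
`(x₁ ⊗ ⋯ ⊗ x_d) ⊗ (y₁ ⊗ ⋯ ⊗ y_d) ↦ (x₁ ⊗ y₁) ⊗ ⋯ ⊗ (x_d ⊗ y_d)`. -/
def regroup : (⨂[𝕜] j, H j) ⊗[𝕜] (⨂[𝕜] j, K j) →ₗ[𝕜] ⨂[𝕜] j, H j ⊗[𝕜] K j :=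
  TensorProduct.lift (PiTensorProduct.map₂ fun j => TensorProduct.mk 𝕜 (H j) (K j))

@[simp]
theorem regroup_tmul (x : ∀ j, H j) (y : ∀ j, K j) :
    regroup 𝕜 H K (PiTensorProduct.tprod 𝕜 x ⊗ₜ[𝕜] PiTensorProduct.tprod 𝕜 y) =
      PiTensorProduct.tprod 𝕜 fun j => x j ⊗ₜ[𝕜] y j := by
  simp [regroup, PiTensorProduct.map₂_tprod_tprod]

variable [Fintype ι] [∀ j, FiniteDimensional 𝕜 (H j)] [∀ j, FiniteDimensional 𝕜 (K j)]

theorem regroup_bijective : Function.Bijective (regroup 𝕜 H K) := by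
  classical
  let b := fun j => Module.finBasis 𝕜 (H j)
  let b' := fun j => Module.finBasis 𝕜 (K j)
  let e := ((Basis.piTensorProduct b).tensorProduct (Basis.piTensorProduct b')).equiv
    (Basis.piTensorProduct fun j => (b j).tensorProduct (b' j))
    (Equiv.arrowProdEquivProdArrow _ _ _).symm
  have : regroup 𝕜 H K = e.toLinearMap := by
    refine ((Basis.piTensorProduct b).tensorProduct (Basis.piTensorProduct b')).ext fun p => ?_
    rw [LinearEquiv.coe_coe, Module.Basis.equiv_apply]
    obtain ⟨p, q⟩ := p
    simp [Equiv.arrowProdEquivProdArrow]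
  rw [this]
  exact e.bijective

variable (𝕜) in
/-- The natural identification map
`J : (H₁ ⊗₂ K₁) ⊗̌ ⋯ ⊗̌ (H_d ⊗₂ K_d) → (H₁ ⊗₂ ⋯ ⊗₂ H_d) ⊗̌ (K₁ ⊗₂ ⋯ ⊗₂ K_d)`,
`(x₁ ⊗ y₁) ⊗ ⋯ ⊗ (x_d ⊗ y_d) ↦ (x₁ ⊗ ⋯ ⊗ x_d) ⊗ (y₁ ⊗ ⋯ ⊗ y_d)` (see `identification_tprod`).
Mathlib's norm on `H j ⊗[𝕜] K j` is the Hilbertian one. -/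
def identification : InjectiveTensor 𝕜 (fun j => H j ⊗[𝕜] K j) →L[𝕜]
    InjectiveTensor₂ 𝕜 (HilbertTensor 𝕜 H) (HilbertTensor 𝕜 K) :=
  LinearMap.toContinuousLinearMap
    ((InjectiveTensor₂.equiv 𝕜 (HilbertTensor 𝕜 H) (HilbertTensor 𝕜 K)).symm.toLinearMap ∘ₗ
      TensorProduct.map (HilbertTensor.equiv 𝕜 H).symm.toLinearMap
        (HilbertTensor.equiv 𝕜 K).symm.toLinearMap ∘ₗ
      (LinearEquiv.ofBijective (regroup 𝕜 H K) (regroup_bijective H K)).symm.toLinearMap ∘ₗ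
      (InjectiveTensor.equiv 𝕜 fun j => H j ⊗[𝕜] K j).toLinearMap)

theorem identification_tprod (x : ∀ j, H j) (y : ∀ j, K j) :
    identification 𝕜 H K ((InjectiveTensor.equiv 𝕜 fun j => H j ⊗[𝕜] K j).symm
      (PiTensorProduct.tprod 𝕜 fun j => x j ⊗ₜ[𝕜] y j)) =
    (InjectiveTensor₂.equiv 𝕜 (HilbertTensor 𝕜 H) (HilbertTensor 𝕜 K)).symm
      (HilbertTensor.tprod 𝕜 x ⊗ₜ[𝕜] HilbertTensor.tprod 𝕜 y) := by
  have : (LinearEquiv.ofBijective (regroup 𝕜 H K) (regroup_bijective H K)).symm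
      (PiTensorProduct.tprod 𝕜 fun j => x j ⊗ₜ[𝕜] y j) =
      PiTensorProduct.tprod 𝕜 x ⊗ₜ[𝕜] PiTensorProduct.tprod 𝕜 y := by
    rw [LinearEquiv.symm_apply_eq]
    simp
  simp [identification, this, HilbertTensor.tprod]

end Identification

end TensorNorms

end

namespace TensorNorms

/-! ### Singular vectors and Hilbert-Schmidt norms -/

section SingularVectors

variable {𝕜 : Type*} [RCLike 𝕜] {E F : Type*} [NormedAddCommGroup E] [InnerProductSpace 𝕜 E]
  [FiniteDimensional 𝕜 E] [NormedAddCommGroup F] [InnerProductSpace 𝕜 F] [FiniteDimensional 𝕜 F]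

/-! Upper bound. In orthonormal coordinates the norm of `J t` is at most the ℓ² norm of the
coordinates of `t` (`norm_identification_ofCoords_le`). The injective norm of `t` dominates the ℓ²
norm of every slice in which only the coordinate of index `j₀` varies (`sum_norm_sq_slice_le`).
Summing the squares over the `∏_{j ≠ j₀} dim H_j dim K_j` slices gives (i).

Lower bound. Take `t` with coordinates `ξ p * η q`, where `ξ` and `η` are families of `N ^ d` signs.
Then `J t` is the elementary tensor `ξ ⊗ η`, of norm `N ^ d`, so it suffices to find signs for which
`t` has injective norm `O(N (log N) ^ (d / 2))`. That norm is controlled by `signForm ξ η A` over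
matrices `A j` of Hilbert-Schmidt norm at most one.

Cutting the singular values of each `A j` into dyadic levels (`exists_dyadic_decomposition`) reduces
this to contractions `A j` of rank at most `r j`, for which the bound sought is `C N √(∏ r j)`
(`exists_signs`); summing over the `O(log N)` levels of each factor costs `√(log N)` per factor, by
Cauchy-Schwarz.

For fixed ranks the bound holds for most signs. The form is a bilinear Rademacher form whose matrix
is a contraction with squared Hilbert-Schmidt norm at most `R = ∏ r j`, so it has a Hanson-Wright
tail (`card_norm_bilinear_rademacher_gt_le`). A union bound over a net of factors `X j`, `Y j`, of
size `exp (O(N ∑ r j))`, concludes when `r j ^ 2 ≤ R` for all `j` (`card_bad_signs_le`). If some `r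
j₀` exceeds the product `ρ` of the other ranks, then the form sees `A j₀` only through a
`ρ`-dimensional space, and `A j₀` can be compressed to rank `ρ` without changing the value
(`exists_compression`); the new ranks satisfy the condition. -/

theorem exists_orthonormalBasis_map_orthogonal (T : E →ₗ[𝕜] F) {n : ℕ}
    (hn : Module.finrank 𝕜 E = n) :
    ∃ b : OrthonormalBasis (Fin n) 𝕜 E, ∀ i j, i ≠ j → inner 𝕜 (T (b i)) (T (b j)) = 0 := by
  have hT : (T.adjoint ∘ₗ T).IsSymmetric := T.isSymmetric_adjoint_comp_self
  -- The right singular vectors of `T`: eigenvectors of `T* T`.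
  refine ⟨hT.eigenvectorBasis hn, fun i j hij => ?_⟩
  rw [← LinearMap.adjoint_inner_right]
  have := hT.apply_eigenvectorBasis hn j
  rw [LinearMap.comp_apply] at this
  rw [this, inner_smul_right, OrthonormalBasis.inner_eq_zero _ hij, mul_zero]

/-- Parseval on both sides and an exchange of sums. Since the two bases are unrelated, the
Hilbert-Schmidt norm does not depend on the basis. -/
theorem sum_norm_sq_map_orthonormalBasis {ι κ : Type*} [Fintype ι] [Fintype κ] (T : E →ₗ[𝕜] F)
    (b : OrthonormalBasis ι 𝕜 E) (c : OrthonormalBasis κ 𝕜 F) :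
    ∑ i, ‖T (b i)‖ ^ 2 = ∑ k, ‖T.adjoint (c k)‖ ^ 2 := by
  simp_rw [← fun x => c.sum_sq_norm_inner_right x, ← fun x => b.sum_sq_norm_inner_left x]
  rw [Finset.sum_comm]
  simp_rw [LinearMap.adjoint_inner_left]

theorem sum_norm_sq_map_orthonormalBasis_eq {ι κ : Type*} [Fintype ι] [Fintype κ] (T : E →ₗ[𝕜] F)
    (b : OrthonormalBasis ι 𝕜 E) (c : OrthonormalBasis κ 𝕜 E) :
    ∑ i, ‖T (b i)‖ ^ 2 = ∑ k, ‖T (c k)‖ ^ 2 := by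
  rw [sum_norm_sq_map_orthonormalBasis T b (stdOrthonormalBasis 𝕜 F),
    sum_norm_sq_map_orthonormalBasis T c (stdOrthonormalBasis 𝕜 F)]

omit [FiniteDimensional 𝕜 E] in
theorem norm_sq_sum_smul_of_orthogonal {ι : Type*} [Fintype ι] (x : ι → E)
    (hx : ∀ i j, i ≠ j → inner 𝕜 (x i) (x j) = 0) (a : ι → 𝕜) :
    ‖∑ i, a i • x i‖ ^ 2 = ∑ i, ‖a i‖ ^ 2 * ‖x i‖ ^ 2 := by
  classical
  have h : ((‖∑ i, a i • x i‖ : 𝕜)) ^ 2 = ((∑ i, ‖a i‖ ^ 2 * ‖x i‖ ^ 2 : ℝ) : 𝕜) := by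
    rw [← inner_self_eq_norm_sq_to_K, sum_inner]
    push_cast
    refine Finset.sum_congr rfl fun i _ => ?_
    rw [inner_sum, Finset.sum_eq_single i]
    · rw [inner_smul_left, inner_smul_right, inner_self_eq_norm_sq_to_K, ← mul_assoc,
        RCLike.conj_mul]
    · intro j _ hj
      rw [inner_smul_left, inner_smul_right, hx i j hj.symm, mul_zero, mul_zero]
    · simp
  exact_mod_cast h

end SingularVectors

/-! ### Exponential moments of Rademacher sums -/

section Rademacher

open MeasureTheory ProbabilityTheory Real

theorem sum_exp_rademacher_le {ι : Type*} [Fintype ι] [DecidableEq ι] (a : ι → ℝ) :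
    ∑ ε : ι → ℤˣ, exp (∑ i, a i * ((ε i : ℤ) : ℝ)) ≤
      2 ^ Fintype.card ι * exp (∑ i, a i ^ 2 / 2) := by
  classical
  calc ∑ ε : ι → ℤˣ, exp (∑ i, a i * ((ε i : ℤ) : ℝ))
      = ∏ i, ∑ s : ℤˣ, exp (a i * ((s : ℤ) : ℝ)) := by
        rw [Finset.prod_univ_sum, Fintype.piFinset_univ]
        simp_rw [exp_sum]
    _ ≤ ∏ i, 2 * exp (a i ^ 2 / 2) := by
        refine Finset.prod_le_prod (fun i _ => by positivity) fun i _ => ?_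
        have h := cosh_le_exp_half_sq (a i)
        rw [cosh_eq] at h
        rw [UnitsInt.univ, Finset.sum_pair (by decide)]
        simp only [Units.val_one, Int.cast_one, mul_one, Units.val_neg, Int.cast_neg, mul_neg]
        linarith
    _ = _ := by
        rw [Finset.prod_mul_distrib, Finset.prod_const, ← exp_sum]
        rfl

theorem integrable_exp_sq_gaussianReal {a : ℝ} (ha : a < 1) :
    Integrable (fun x : ℝ => exp (a * x ^ 2 / 2)) (gaussianReal 0 1) := by
  rw [gaussianReal_of_var_ne_zero 0 one_ne_zero,
    integrable_withDensity_iff_integrable_smul' (measurable_gaussianPDF _ _)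
      (ae_of_all _ fun _ => by simp [gaussianPDF])]
  have h := (integrable_exp_neg_mul_sq (b := (1 - a) / 2) (by linarith)).const_mul (√(2 * π))⁻¹
  refine h.congr (ae_of_all _ fun x => ?_)
  simp only [toReal_gaussianPDF, gaussianPDFReal, smul_eq_mul, NNReal.coe_one, mul_one, sub_zero]
  rw [mul_assoc, ← exp_add]
  congr 2
  ring

theorem integral_exp_sq_gaussianReal_le {a : ℝ} (ha0 : 0 ≤ a) (ha : a ≤ 1 / 4) :
    ∫ x : ℝ, exp (a * x ^ 2 / 2) ∂(gaussianReal 0 1) ≤ exp a := by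
  have h : ∫ x : ℝ, exp (a * x ^ 2 / 2) ∂(gaussianReal 0 1) = √(1 / (1 - a)) := by
    rw [integral_gaussianReal_eq_integral_smul one_ne_zero]
    have : ∀ x : ℝ, gaussianPDFReal 0 1 x • exp (a * x ^ 2 / 2) =
        (√(2 * π))⁻¹ * exp (-((1 - a) / 2) * x ^ 2) := fun x => by
      simp only [gaussianPDFReal, smul_eq_mul, NNReal.coe_one, mul_one, sub_zero]
      rw [mul_assoc, ← exp_add]
      congr 2
      ring
    simp_rw [this]
    rw [integral_const_mul, integral_gaussian, ← sqrt_inv, ← sqrt_mul (by positivity)]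
    congr 1
    have : 1 - a ≠ 0 := by linarith
    field_simp
  rw [h, sqrt_le_left (exp_pos a).le, ← exp_nat_mul, div_le_iff₀ (by linarith)]
  have := add_one_le_exp ((2 : ℕ) * a)
  push_cast at *
  -- `(1 - a) e^{2a} ≥ (1 - a)(1 + 2a) = 1 + a - 2a² ≥ 1`, because `a ≤ 1 / 2`.
  nlinarith

theorem integral_exp_mul_gaussianReal (z : ℝ) :
    ∫ x : ℝ, exp (z * x) ∂(gaussianReal 0 1) = exp (z ^ 2 / 2) := by
  have := mgf_gaussianReal (p := gaussianReal 0 1) (X := id) (μ := 0) (v := 1) (by simp) z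
  simpa [mgf] using this

/-- The exponential moments of a quadratic form of random signs are bounded like those of the same
quadratic form of Gaussian variables: `(∑ᵢ wₖᵢ εᵢ)²` is linearized by an auxiliary Gaussian. -/
theorem sum_exp_quadratic_rademacher_le {ι κ : Type*} [Fintype ι] [DecidableEq ι] [Fintype κ]
    (w : κ → ι → ℝ)
    (c : κ → ℝ) (hc0 : ∀ k, 0 ≤ c k) (hc : ∀ k, c k ≤ 1 / 4)
    (hw : ∀ y : κ → ℝ, ∑ i, (∑ k, y k * w k i) ^ 2 ≤ ∑ k, c k * y k ^ 2) :
    ∑ ε : ι → ℤˣ, exp (∑ k, (∑ i, w k i * ((ε i : ℤ) : ℝ)) ^ 2 / 2) ≤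
      2 ^ Fintype.card ι * exp (∑ k, c k) := by
  let γ : Measure (κ → ℝ) := Measure.pi fun _ => gaussianReal 0 1
  -- The linearization: after exchanging sum and integral, the signs enter the exponent linearly and
  -- can be averaged one by one. The hypothesis `hw` then bounds the result by a diagonal Gaussian
  -- integral.
  have hlin (z : κ → ℝ) : exp (∑ k, z k ^ 2 / 2) = ∫ y, ∏ k, exp (z k * y k) ∂γ := by
    rw [integral_fintype_prod_eq_prod (f := fun k x => exp (z k * x)), exp_sum]
    simp_rw [integral_exp_mul_gaussianReal]
  have hint (z : κ → ℝ) : Integrable (fun y : κ → ℝ => ∏ k, exp (z k * y k)) γ :=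
    Integrable.fintype_prod (f := fun k x => exp (z k * x)) fun k =>
      ProbabilityTheory.integrable_exp_mul_gaussianReal _
  have hint' : Integrable (fun y : κ → ℝ => ∏ k, exp (c k * y k ^ 2 / 2)) γ :=
    Integrable.fintype_prod (f := fun k x => exp (c k * x ^ 2 / 2)) fun k =>
      integrable_exp_sq_gaussianReal ((hc k).trans_lt (by norm_num))
  calc ∑ ε : ι → ℤˣ, exp (∑ k, (∑ i, w k i * ((ε i : ℤ) : ℝ)) ^ 2 / 2)
      = ∫ y, ∑ ε : ι → ℤˣ, ∏ k, exp ((∑ i, w k i * ((ε i : ℤ) : ℝ)) * y k) ∂γ := by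
        rw [integral_finsetSum _ fun ε _ => hint _]
        simp_rw [hlin]
    _ ≤ ∫ y, 2 ^ Fintype.card ι * ∏ k, exp (c k * y k ^ 2 / 2) ∂γ := by
        refine integral_mono (integrable_finsetSum _ fun ε _ => hint _)
          (hint'.const_mul _) fun y => ?_
        simp only
        calc ∑ ε : ι → ℤˣ, ∏ k, exp ((∑ i, w k i * ((ε i : ℤ) : ℝ)) * y k)
            = ∑ ε : ι → ℤˣ, exp (∑ i, (∑ k, y k * w k i) * ((ε i : ℤ) : ℝ)) := by
              refine Finset.sum_congr rfl fun ε _ => ?_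
              rw [← exp_sum]
              congr 1
              simp_rw [Finset.sum_mul]
              rw [Finset.sum_comm]
              refine Finset.sum_congr rfl fun i _ => Finset.sum_congr rfl fun k _ => ?_
              ring
          _ ≤ _ := sum_exp_rademacher_le _
          _ ≤ _ := by
              rw [← exp_sum, ← Finset.sum_div, ← Finset.sum_div]
              gcongr
              exact hw y
    _ = 2 ^ Fintype.card ι * ∏ k, ∫ x, exp (c k * x ^ 2 / 2) ∂(gaussianReal 0 1) := by
        rw [integral_const_mul,
          integral_fintype_prod_eq_prod (f := fun k x => exp (c k * x ^ 2 / 2))]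
    _ ≤ _ := by
        rw [exp_sum]
        gcongr with k
        exact integral_exp_sq_gaussianReal_le (hc0 k) (hc k)

end Rademacher

/-! ### Contractive matrices -/

section Contraction

variable {𝕜 : Type*} [RCLike 𝕜] {m n l : Type*} [Fintype m] [Fintype n] [Fintype l]

/-- A matrix of norm at most one, as an operator between Euclidean spaces. -/
def IsContraction (X : Matrix m n 𝕜) : Prop :=
  ∀ v : n → 𝕜, ∑ p, ‖X.mulVec v p‖ ^ 2 ≤ ∑ k, ‖v k‖ ^ 2

theorem norm_sum_mul_sq_le (x y : n → 𝕜) :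
    ‖∑ k, x k * y k‖ ^ 2 ≤ (∑ k, ‖x k‖ ^ 2) * ∑ k, ‖y k‖ ^ 2 := by
  calc ‖∑ k, x k * y k‖ ^ 2 ≤ (∑ k, ‖x k‖ * ‖y k‖) ^ 2 := by
        gcongr
        exact (norm_sum_le _ _).trans_eq (by simp_rw [norm_mul])
    _ ≤ _ := Finset.sum_mul_sq_le_sq_mul_sq _ _ _

theorem IsContraction.norm_sum_sq_le {X : Matrix m n 𝕜} (hX : IsContraction X) (u : m → 𝕜)
    (v : n → 𝕜) :
    ‖∑ p, ∑ k, u p * X p k * v k‖ ^ 2 ≤ (∑ p, ‖u p‖ ^ 2) * ∑ k, ‖v k‖ ^ 2 := by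
  have : ∑ p, ∑ k, u p * X p k * v k = ∑ p, u p * X.mulVec v p := by
    simp only [Matrix.mulVec, dotProduct, Finset.mul_sum, mul_assoc]
  rw [this]
  refine (norm_sum_mul_sq_le _ _).trans ?_
  gcongr
  exact hX v

theorem IsContraction.of_norm_sum_sq_le {X : Matrix m n 𝕜}
    (h : ∀ (u : m → 𝕜) (v : n → 𝕜),
      ‖∑ p, ∑ k, u p * X p k * v k‖ ^ 2 ≤ (∑ p, ‖u p‖ ^ 2) * ∑ k, ‖v k‖ ^ 2) :
    IsContraction X := by
  intro v
  -- Testing against the conjugate of `X v` turns the bilinear form into `‖X v‖²`, and one factor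
  -- `‖X v‖²` cancels.
  have h1 := h (fun p => star (X.mulVec v p)) v
  have h2 : ∑ p, ∑ k, star (X.mulVec v p) * X p k * v k =
      ((∑ p, ‖X.mulVec v p‖ ^ 2 : ℝ) : 𝕜) := by
    push_cast
    refine Finset.sum_congr rfl fun p _ => ?_
    rw [← RCLike.conj_mul]
    simp only [mul_assoc, ← Finset.mul_sum]
    rfl
  rw [h2, RCLike.norm_ofReal, sq_abs] at h1
  simp only [norm_star] at h1
  rcases (show 0 ≤ ∑ p, ‖X.mulVec v p‖ ^ 2 by positivity).eq_or_lt with h0 | h0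
  · rw [← h0]
    positivity
  · rw [sq] at h1
    exact le_of_mul_le_mul_left h1 h0

theorem IsContraction.transpose {X : Matrix m n 𝕜} (hX : IsContraction X) :
    IsContraction X.transpose := by
  refine .of_norm_sum_sq_le fun u v => ?_
  rw [Finset.sum_comm, mul_comm]
  refine (le_of_eq ?_).trans (hX.norm_sum_sq_le v u)
  simp only [Matrix.transpose_apply]
  congr 2
  refine Finset.sum_congr rfl fun p _ => Finset.sum_congr rfl fun k _ => ?_
  ring

theorem IsContraction.mul {X : Matrix m n 𝕜} {Y : Matrix n l 𝕜} (hX : IsContraction X)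
    (hY : IsContraction Y) : IsContraction (X * Y) := by
  intro v
  rw [← Matrix.mulVec_mulVec]
  exact (hX _).trans (hY v)

/-- Used with `f` the real or the imaginary part: on real vectors, `f` commutes with the action of
the matrix. -/
theorem IsContraction.map_real {X : Matrix m n 𝕜} (hX : IsContraction X) (f : 𝕜 →ₗ[ℝ] ℝ)
    (hf : ∀ z, |f z| ≤ ‖z‖) : IsContraction (X.map f) := by
  intro v
  have h := hX fun k => (v k : 𝕜)
  simp only [RCLike.norm_ofReal] at h
  refine le_trans (Finset.sum_le_sum fun p _ => ?_) (h.trans_eq (by simp))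
  gcongr
  refine (le_of_eq ?_).trans (hf _)
  rw [Real.norm_eq_abs]
  congr 1
  simp only [Matrix.mulVec, dotProduct, Matrix.map_apply, map_sum]
  refine Finset.sum_congr rfl fun k _ => ?_
  rw [mul_comm, mul_comm (X p k), ← RCLike.real_smul_eq_coe_mul, map_smul, smul_eq_mul]

theorem sum_norm_sq_mul_le {X : Matrix m n 𝕜} (hX : IsContraction X) (Y : Matrix n l 𝕜) :
    ∑ p, ∑ k, ‖(X * Y) p k‖ ^ 2 ≤ ∑ q, ∑ k, ‖Y q k‖ ^ 2 := by
  rw [Finset.sum_comm, Finset.sum_comm (f := fun q k => ‖Y q k‖ ^ 2)]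
  exact Finset.sum_le_sum fun k _ => hX fun q => Y q k

theorem IsContraction.sum_norm_sq_le [DecidableEq n] {X : Matrix m n 𝕜} (hX : IsContraction X) :
    ∑ p, ∑ k, ‖X p k‖ ^ 2 ≤ Fintype.card n := by
  have := sum_norm_sq_mul_le hX (1 : Matrix n n 𝕜)
  refine (this.trans_eq' (by rw [Matrix.mul_one])).trans_eq ?_
  simp [Matrix.one_apply, apply_ite, ite_pow]

end Contraction

/-! ### Tails of bilinear Rademacher forms -/

section RademacherTail

open Real

variable {m n : Type*} [Fintype m] [Fintype n] [DecidableEq m] [DecidableEq n]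

/-- Averaging over `η` leaves the exponential of `t² ‖Bᵀ ξ‖² / 2`. In the singular basis `b k` of
`Bᵀ` this is a sum of squares of linear forms in `ξ`, to which the quadratic estimate applies. The
condition on `t` keeps its coefficients `t² ‖Bᵀ b k‖²` below `1 / 4`. -/
theorem sum_exp_bilinear_rademacher_le {B : Matrix m n ℝ} (hB : IsContraction B) {t : ℝ}
    (ht : t ^ 2 ≤ 1 / 4) :
    ∑ ξ : m → ℤˣ, ∑ η : n → ℤˣ,
        exp (t * ∑ p, ∑ q, ((ξ p : ℤ) : ℝ) * ((η q : ℤ) : ℝ) * B p q) ≤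
      2 ^ Fintype.card m * 2 ^ Fintype.card n * exp (t ^ 2 * ∑ p, ∑ q, B p q ^ 2) := by
  let T : EuclideanSpace ℝ m →ₗ[ℝ] EuclideanSpace ℝ n := Matrix.toEuclideanLin B.transpose
  have hT (v : EuclideanSpace ℝ m) : ‖T v‖ ^ 2 = ∑ q, (∑ p, v p * B p q) ^ 2 := by
    simp [T, EuclideanSpace.norm_sq_eq, Matrix.mulVec, dotProduct, mul_comm]
  obtain ⟨b, hb⟩ := exists_orthonormalBasis_map_orthogonal T (finrank_euclideanSpace (ι := m))
  have hHS : ∑ k, ‖T (b k)‖ ^ 2 = ∑ p, ∑ q, B p q ^ 2 := by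
    rw [sum_norm_sq_map_orthonormalBasis_eq T b (EuclideanSpace.basisFun m ℝ)]
    refine Finset.sum_congr rfl fun p _ => ?_
    rw [hT]
    simp
  have hTb (k) : ‖T (b k)‖ ^ 2 ≤ 1 := by
    have h1 := hB.transpose (b k)
    have h2 : ‖b k‖ ^ 2 = 1 := by rw [b.norm_eq_one, one_pow]
    rw [← EuclideanSpace.norm_sq_eq, h2] at h1
    rw [EuclideanSpace.norm_sq_eq]
    exact h1
  have hdecomp (v : EuclideanSpace ℝ m) :
      ‖T v‖ ^ 2 = ∑ k, (∑ i, ‖T (b k)‖ * b k i * v i) ^ 2 := by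
    conv_lhs => rw [← b.sum_repr' v, map_sum]
    simp_rw [map_smul]
    rw [norm_sq_sum_smul_of_orthogonal _ hb]
    refine Finset.sum_congr rfl fun k _ => ?_
    rw [norm_eq_abs, sq_abs, ← mul_pow]
    congr 1
    simp only [PiLp.inner_apply, RCLike.inner_apply, conj_trivial, Finset.sum_mul]
    exact Finset.sum_congr rfl fun i _ => by ring
  calc ∑ ξ : m → ℤˣ, ∑ η : n → ℤˣ,
        exp (t * ∑ p, ∑ q, ((ξ p : ℤ) : ℝ) * ((η q : ℤ) : ℝ) * B p q)
      ≤ ∑ ξ : m → ℤˣ, 2 ^ Fintype.card n *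
          exp (∑ k, (∑ i, (t * ‖T (b k)‖ * b k i) * ((ξ i : ℤ) : ℝ)) ^ 2 / 2) := by
        refine Finset.sum_le_sum fun ξ _ => ?_
        have h1 := sum_exp_rademacher_le fun q => t * ∑ p, ((ξ p : ℤ) : ℝ) * B p q
        refine (le_of_eq ?_).trans (h1.trans_eq ?_)
        · refine Finset.sum_congr rfl fun η _ => ?_
          congr 1
          rw [Finset.sum_comm, Finset.mul_sum]
          refine Finset.sum_congr rfl fun q _ => ?_
          rw [mul_assoc, Finset.sum_mul]
          congr 1
          exact Finset.sum_congr rfl fun p _ => by ring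
        · congr 2
          have h2 := (hT (WithLp.toLp 2 fun p => ((ξ p : ℤ) : ℝ))).symm.trans (hdecomp _)
          simp only [mul_pow, ← Finset.sum_div, ← Finset.mul_sum, mul_assoc] at h2 ⊢
          rw [h2]
    _ ≤ 2 ^ Fintype.card n * (2 ^ Fintype.card m * exp (∑ k, t ^ 2 * ‖T (b k)‖ ^ 2)) := by
        rw [← Finset.mul_sum]
        gcongr
        refine sum_exp_quadratic_rademacher_le _ _ (fun k => by positivity) (fun k => ?_)
          fun y => ?_
        · nlinarith [hTb k, sq_nonneg t]
        · have h1 := norm_sq_sum_smul_of_orthogonal b (fun i j hij => b.inner_eq_zero hij)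
            fun k => y k * (t * ‖T (b k)‖)
          rw [EuclideanSpace.norm_sq_eq] at h1
          refine (le_of_eq ?_).trans (h1.trans_le (le_of_eq ?_))
          · refine Finset.sum_congr rfl fun i _ => ?_
            simp [mul_assoc]
          · refine Finset.sum_congr rfl fun k _ => ?_
            rw [b.norm_eq_one, norm_eq_abs, sq_abs]
            ring
    _ = _ := by rw [← Finset.mul_sum, hHS]; ring

/-- Markov's inequality for the exponential moment, as a count of signs. `t` may be negative, so
that the same statement gives both tails. -/
theorem card_bilinear_rademacher_gt_le {B : Matrix m n ℝ} (hB : IsContraction B) {t T : ℝ}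
    (ht : t ^ 2 ≤ 1 / 4) :
    (({ε : (m → ℤˣ) × (n → ℤˣ) |
        t * T ≤ t * ∑ p, ∑ q, ((ε.1 p : ℤ) : ℝ) * ((ε.2 q : ℤ) : ℝ) * B p q} : Finset _).card : ℝ) ≤
      2 ^ Fintype.card m * 2 ^ Fintype.card n * exp (t ^ 2 * ∑ p, ∑ q, B p q ^ 2 - t * T) := by
  rw [exp_sub, ← mul_div_assoc, le_div_iff₀ (exp_pos _)]
  refine le_trans ?_ (sum_exp_bilinear_rademacher_le hB ht)
  rw [← Fintype.sum_prod_type', Finset.card_eq_sum_ones, Nat.cast_sum, Finset.sum_mul]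
  refine (Finset.sum_le_sum fun ε hε => ?_).trans
    (Finset.sum_le_univ_sum_of_nonneg fun ε => (exp_pos _).le)
  rw [Nat.cast_one, one_mul]
  exact exp_le_exp.mpr (Finset.mem_filter.mp hε).2

theorem card_abs_bilinear_rademacher_gt_le {B : Matrix m n ℝ} (hB : IsContraction B) {t T : ℝ}
    (ht0 : 0 ≤ t) (ht : t ≤ 1 / 2) :
    (({ε : (m → ℤˣ) × (n → ℤˣ) |
        T ≤ |∑ p, ∑ q, ((ε.1 p : ℤ) : ℝ) * ((ε.2 q : ℤ) : ℝ) * B p q|} : Finset _).card : ℝ) ≤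
      2 * (2 ^ Fintype.card m * 2 ^ Fintype.card n *
        exp (t ^ 2 * ∑ p, ∑ q, B p q ^ 2 - t * T)) := by
  have h1 := card_bilinear_rademacher_gt_le hB (t := t) (T := T) (by nlinarith)
  have h2 := card_bilinear_rademacher_gt_le hB (t := -t) (T := -T) (by nlinarith)
  rw [neg_sq, neg_mul_neg] at h2
  rw [two_mul]
  refine le_trans ?_ (add_le_add h1 h2)
  rw [← Nat.cast_add, Nat.cast_le]
  refine (Finset.card_le_card fun ε hε => ?_).trans (Finset.card_union_le _ _)
  simp only [Finset.mem_union, Finset.mem_filter, Finset.mem_univ, true_and, le_abs] at hε ⊢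
  refine hε.imp (fun h => by gcongr) fun h => ?_
  nlinarith

variable {𝕜 : Type*} [RCLike 𝕜]

theorem card_norm_bilinear_rademacher_gt_le {A : Matrix m n 𝕜} (hA : IsContraction A) {t T : ℝ}
    (ht0 : 0 ≤ t) (ht : t ≤ 1 / 2) :
    (({ε : (m → ℤˣ) × (n → ℤˣ) |
        2 * T < ‖∑ p, ∑ q, (((ε.1 p : ℤ) : 𝕜) * ((ε.2 q : ℤ) : 𝕜) * A p q)‖} :
          Finset _).card : ℝ) ≤
      4 * (2 ^ Fintype.card m * 2 ^ Fintype.card n *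
        exp (t ^ 2 * ∑ p, ∑ q, ‖A p q‖ ^ 2 - t * T)) := by
  -- The real and imaginary parts are treated separately: a norm above `2 T` forces one of them to
  -- be at least `T` in absolute value.
  have key (f : 𝕜 →ₗ[ℝ] ℝ) (hf : ∀ z, |f z| ≤ ‖z‖) :
      (({ε : (m → ℤˣ) × (n → ℤˣ) |
        T ≤ |f (∑ p, ∑ q, (((ε.1 p : ℤ) : 𝕜) * ((ε.2 q : ℤ) : 𝕜) * A p q))|} :
          Finset _).card : ℝ) ≤
      2 * (2 ^ Fintype.card m * 2 ^ Fintype.card n *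
        exp (t ^ 2 * ∑ p, ∑ q, ‖A p q‖ ^ 2 - t * T)) := by
    have h := card_abs_bilinear_rademacher_gt_le (hA.map_real f hf) (T := T) ht0 ht
    have he (ε : (m → ℤˣ) × (n → ℤˣ)) :
        f (∑ p, ∑ q, (((ε.1 p : ℤ) : 𝕜) * ((ε.2 q : ℤ) : 𝕜) * A p q)) =
          ∑ p, ∑ q, ((ε.1 p : ℤ) : ℝ) * ((ε.2 q : ℤ) : ℝ) * A.map f p q := by
      simp only [map_sum]
      refine Finset.sum_congr rfl fun p _ => Finset.sum_congr rfl fun q _ => ?_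
      rw [Matrix.map_apply, ← smul_eq_mul (_ * _ : ℝ), ← map_smul, RCLike.real_smul_eq_coe_mul]
      push_cast
      rfl
    simp_rw [he]
    refine h.trans ?_
    have hsq (p q) : A.map f p q ^ 2 ≤ ‖A p q‖ ^ 2 :=
      sq_le_sq.mpr ((hf _).trans_eq (abs_norm _).symm)
    have hsum := Finset.sum_le_sum fun p (_ : p ∈ Finset.univ) =>
      Finset.sum_le_sum fun q (_ : q ∈ Finset.univ) => hsq p q
    gcongr
  have h1 := key RCLike.reLm RCLike.abs_re_le_norm
  have h2 := key RCLike.imLm RCLike.abs_im_le_norm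
  rw [show (4 : ℝ) = 2 + 2 by norm_num, add_mul]
  refine le_trans ?_ (add_le_add h1 h2)
  rw [← Nat.cast_add, Nat.cast_le]
  refine (Finset.card_le_card fun ε hε => ?_).trans (Finset.card_union_le _ _)
  simp only [Finset.mem_union, Finset.mem_filter, Finset.mem_univ, true_and] at hε ⊢
  by_contra! h
  have h0 (z : 𝕜) : ‖z‖ ≤ |RCLike.re z| + |RCLike.im z| := by
    conv_lhs => rw [← RCLike.re_add_im z]
    refine (norm_add_le _ _).trans ?_
    rw [norm_mul, RCLike.norm_ofReal, RCLike.norm_ofReal]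
    gcongr
    refine mul_le_of_le_one_right (abs_nonneg _) ?_
    rw [RCLike.norm_I]
    split_ifs <;> norm_num
  have := h0 (∑ p, ∑ q, (((ε.1 p : ℤ) : 𝕜) * ((ε.2 q : ℤ) : 𝕜) * A p q))
  simp only [RCLike.reLm_coe, RCLike.imLm_coe] at h
  linarith [h.1, h.2]

end RademacherTail

/-! ### Nets -/

section Nets

theorem exists_finset_norm_le_two_mul (E : Type*) [NormedAddCommGroup E] [NormedSpace ℝ E]
    [FiniteDimensional ℝ E] :
    ∃ K : Finset E, K.card ≤ 5 ^ Module.finrank ℝ E ∧ (∀ x ∈ K, ‖x‖ ≤ 1) ∧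
      ∀ {F : Type*} [NormedAddCommGroup F] [NormedSpace ℝ F] (f : E →ₗ[ℝ] F) (T : ℝ), 0 ≤ T →
        (∀ x ∈ K, ‖f x‖ ≤ T) → ∀ x, ‖x‖ ≤ 1 → ‖f x‖ ≤ 2 * T := by
  classical
  -- A maximal 1-separated subset of the ball of radius 2, halved, is a `1/2`-net of the unit ball.
  -- For such a net, `‖f‖ ≤ T + ‖f‖ / 2`, hence `‖f‖ ≤ 2 T`.
  let Sep (s : Finset E) : Prop :=
    (∀ c ∈ s, ‖c‖ ≤ 2) ∧ ∀ c ∈ s, ∀ d ∈ s, c ≠ d → 1 ≤ ‖c - d‖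
  have hbdd : ∃ s, Sep s ∧ ∀ s', Sep s' → s'.card ≤ s.card := by
    have hP : ∃ k, ∃ s, Sep s ∧ s.card = k := ⟨0, ∅, by simp [Sep], rfl⟩
    have hle : ∀ k, (∃ s, Sep s ∧ s.card = k) → k ≤ 5 ^ Module.finrank ℝ E := by
      rintro _ ⟨s, hs, rfl⟩
      exact Besicovitch.card_le_of_separated s hs.1 hs.2
    obtain ⟨k, hk⟩ := hP
    obtain ⟨s, hs, hsk⟩ := Nat.findGreatest_spec (P := fun k => ∃ s, Sep s ∧ s.card = k)
      (hle k hk) hk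
    refine ⟨s, hs, fun s' hs' => ?_⟩
    rw [hsk]
    exact Nat.le_findGreatest (hle _ ⟨s', hs', rfl⟩) ⟨s', hs', rfl⟩
  obtain ⟨s, hs, hmax⟩ := hbdd
  refine ⟨s.image fun x => (2⁻¹ : ℝ) • x, Finset.card_image_le.trans
    (Besicovitch.card_le_of_separated s hs.1 hs.2), ?_, ?_⟩
  · intro x hx
    obtain ⟨y, hy, rfl⟩ := Finset.mem_image.mp hx
    rw [norm_smul]
    norm_num
    linarith [hs.1 y hy]
  intro F _ _ f T hT hf
  have hnet (x : E) (hx : ‖x‖ ≤ 1) : ∃ y ∈ s, ‖x - (2⁻¹ : ℝ) • y‖ ≤ 2⁻¹ := by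
    by_contra! hcon
    have hfar (y) (hy : y ∈ s) : 1 ≤ ‖(2 : ℝ) • x - y‖ := by
      have h := hcon y hy
      have : (2 : ℝ) • x - y = (2 : ℝ) • (x - (2⁻¹ : ℝ) • y) := by
        rw [smul_sub, smul_smul]
        norm_num
      rw [this, norm_smul]
      norm_num
      linarith
    have hnot : (2 : ℝ) • x ∉ s := fun h => by
      have := hfar _ h
      rw [sub_self, norm_zero] at this
      norm_num at this
    have := hmax (insert ((2 : ℝ) • x) s) ⟨?_, ?_⟩
    · rw [Finset.card_insert_of_notMem hnot] at this
      omega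
    · intro c hc
      rcases Finset.mem_insert.mp hc with rfl | hc
      · rw [norm_smul]
        norm_num
        linarith
      · exact hs.1 c hc
    · intro c hc d hd hcd
      rcases Finset.mem_insert.mp hc with rfl | hc <;> rcases Finset.mem_insert.mp hd with rfl | hd
      · exact absurd rfl hcd
      · exact hfar d hd
      · rw [norm_sub_rev]
        exact hfar c hc
      · exact hs.2 c hc d hd hcd
  let g : E →L[ℝ] F := ⟨f, f.continuous_of_finiteDimensional⟩
  have hgf : ∀ x, g x = f x := fun _ => rfl
  have hball (x : E) (hx : ‖x‖ ≤ 1) : ‖f x‖ ≤ T + 2⁻¹ * ‖g‖ := by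
    obtain ⟨y, hy, hxy⟩ := hnet x hx
    have h1 := hf _ (Finset.mem_image_of_mem (fun x => (2⁻¹ : ℝ) • x) hy)
    have h2 := g.le_opNorm (x - (2⁻¹ : ℝ) • y)
    rw [map_sub, hgf, hgf] at h2
    have h3 : ‖g‖ * ‖x - (2⁻¹ : ℝ) • y‖ ≤ ‖g‖ * 2⁻¹ := by gcongr
    have h4 := norm_le_norm_add_norm_sub' (f x) (f ((2⁻¹ : ℝ) • y))
    linarith
  have hg : ‖g‖ ≤ T + 2⁻¹ * ‖g‖ :=
    ContinuousLinearMap.opNorm_le_of_unit_norm (by positivity) fun x hx => hball x hx.le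
  intro x hx
  have := hball x hx
  linarith

theorem isContraction_iff_norm_toEuclideanLin {𝕜 : Type*} [RCLike 𝕜] {m n : Type*} [Fintype m]
    [Fintype n] [DecidableEq n] (X : Matrix m n 𝕜) :
    IsContraction X ↔ ‖LinearMap.toContinuousLinearMap (Matrix.toEuclideanLin X)‖ ≤ 1 := by
  constructor
  · intro h
    refine ContinuousLinearMap.opNorm_le_bound _ zero_le_one fun x => ?_
    rw [one_mul, ← sq_le_sq₀ (norm_nonneg _) (norm_nonneg _), EuclideanSpace.norm_sq_eq,
      EuclideanSpace.norm_sq_eq]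
    exact h x
  · intro h v
    have := ContinuousLinearMap.le_of_opNorm_le _ h (WithLp.toLp 2 v)
    rw [one_mul, ← sq_le_sq₀ (norm_nonneg _) (norm_nonneg _), EuclideanSpace.norm_sq_eq,
      EuclideanSpace.norm_sq_eq] at this
    exact this

theorem exists_finset_norm_le_two_mul' (𝕜 : Type*) [RCLike 𝕜] (E : Type*) [NormedAddCommGroup E]
    [NormedSpace 𝕜 E] [FiniteDimensional 𝕜 E] :
    ∃ K : Finset E, K.card ≤ 5 ^ (2 * Module.finrank 𝕜 E) ∧ (∀ x ∈ K, ‖x‖ ≤ 1) ∧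
      ∀ (f : E →ₗ[𝕜] 𝕜) (T : ℝ), 0 ≤ T →
        (∀ x ∈ K, ‖f x‖ ≤ T) → ∀ x, ‖x‖ ≤ 1 → ‖f x‖ ≤ 2 * T := by
  let _ : NormedSpace ℝ E := NormedSpace.restrictScalars ℝ 𝕜 E
  have _ : IsScalarTower ℝ 𝕜 E := RestrictScalars.isScalarTower ℝ 𝕜 E
  have _ : FiniteDimensional ℝ E := FiniteDimensional.trans ℝ 𝕜 E
  have hdim : Module.finrank ℝ E ≤ 2 * Module.finrank 𝕜 E := by
    rw [← Module.finrank_mul_finrank ℝ 𝕜 E]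
    gcongr
    exact RCLike.finrank_le_two 𝕜
  obtain ⟨K, hcard, hK, hnet⟩ := exists_finset_norm_le_two_mul E
  exact ⟨K, hcard.trans (Nat.pow_le_pow_right (by norm_num) hdim), hK,
    fun f => hnet (f.restrictScalars ℝ)⟩

theorem exists_finset_contraction (𝕜 : Type*) [RCLike 𝕜] (m n : Type*) [Fintype m]
    [Fintype n] [DecidableEq n] :
    ∃ K : Finset (Matrix m n 𝕜), K.card ≤ 5 ^ (2 * (Fintype.card m * Fintype.card n)) ∧
      (∀ X ∈ K, IsContraction X) ∧
      ∀ (f : Matrix m n 𝕜 →ₗ[𝕜] 𝕜) (T : ℝ), 0 ≤ T →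
        (∀ X ∈ K, ‖f X‖ ≤ T) → ∀ X, IsContraction X → ‖f X‖ ≤ 2 * T := by
  classical
  let e : Matrix m n 𝕜 ≃ₗ[𝕜] EuclideanSpace 𝕜 n →L[𝕜] EuclideanSpace 𝕜 m :=
    Matrix.toEuclideanLin.trans LinearMap.toContinuousLinearMap
  have he (X : Matrix m n 𝕜) : IsContraction X ↔ ‖e X‖ ≤ 1 :=
    isContraction_iff_norm_toEuclideanLin X
  obtain ⟨K, hcard, hK, hnet⟩ :=
    exists_finset_norm_le_two_mul' 𝕜 (EuclideanSpace 𝕜 n →L[𝕜] EuclideanSpace 𝕜 m)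
  rw [← e.finrank_eq, Module.finrank_matrix, Module.finrank_self, mul_one] at hcard
  refine ⟨K.image e.symm, Finset.card_image_le.trans hcard, ?_, fun f T hT hf X hX => ?_⟩
  · intro X hX
    obtain ⟨y, hy, rfl⟩ := Finset.mem_image.mp hX
    rw [he, e.apply_symm_apply]
    exact hK y hy
  · have := hnet (f ∘ₗ e.symm.toLinearMap) T hT
      (fun x hx => hf _ (Finset.mem_image_of_mem _ hx)) (e X) ((he X).mp hX)
    simpa using this

/-- The arguments are released from the nets to the sets `B i` one at a time, each at the cost of a
factor 2. The induction runs over the set of released arguments. -/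
theorem _root_.MultilinearMap.norm_le_two_pow_mul {𝕜 : Type*} [RCLike 𝕜] {ι : Type*} [Fintype ι]
    {E : ι → Type*} [∀ i, AddCommGroup (E i)] [∀ i, Module 𝕜 (E i)] (K : ∀ i, Finset (E i))
    (B : ∀ i, Set (E i))
    (hK : ∀ i (f : E i →ₗ[𝕜] 𝕜) (T : ℝ), 0 ≤ T → (∀ x ∈ K i, ‖f x‖ ≤ T) →
      ∀ x ∈ B i, ‖f x‖ ≤ 2 * T)
    (f : MultilinearMap 𝕜 E 𝕜) {T : ℝ} (hT : 0 ≤ T) (hf : ∀ x, (∀ i, x i ∈ K i) → ‖f x‖ ≤ T)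
    (x : ∀ i, E i) (hx : ∀ i, x i ∈ B i) : ‖f x‖ ≤ 2 ^ Fintype.card ι * T := by
  classical
  suffices h : ∀ s : Finset ι, ∀ x : ∀ i, E i, (∀ i ∈ s, x i ∈ B i) → (∀ i ∉ s, x i ∈ K i) →
      ‖f x‖ ≤ 2 ^ s.card * T from
    h Finset.univ x (fun i _ => hx i) (fun i hi => absurd (Finset.mem_univ i) hi)
  intro s
  induction s using Finset.induction_on with
  | empty => intro x _ hx; simpa using hf x fun i => hx i (by simp)
  | insert j s hj ih =>
    intro x hxB hxK
    have := hK j (f.toLinearMap x j) (2 ^ s.card * T) (by positivity) (fun y hy => ?_) (x j)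
      (hxB j (by simp))
    · rw [MultilinearMap.toLinearMap_apply, Function.update_eq_self] at this
      rw [Finset.card_insert_of_notMem hj, pow_succ]
      linarith
    · refine ih _ (fun i hi => ?_) fun i hi => ?_
      · rw [Function.update_of_ne (by rintro rfl; exact hj hi)]
        exact hxB i (by simp [hi])
      · by_cases hij : i = j
        · subst hij
          simpa using hy
        · rw [Function.update_of_ne hij]
          exact hxK i (by simp [hi, hij])

end Nets

/-! ### Tensor products of matrices -/

section TensorMatrix

variable {𝕜 : Type*} [RCLike 𝕜]

/-- The Kronecker product of a finite family of matrices. -/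
def tensorMatrix {ι : Type*} [Fintype ι] {m n : ι → Type*} (A : ∀ j, Matrix (m j) (n j) 𝕜) :
    Matrix (∀ j, m j) (∀ j, n j) 𝕜 :=
  fun p q => ∏ j, A j (p j) (q j)

theorem tensorMatrix_mul_transpose {ι : Type*} [Fintype ι] [DecidableEq ι] {m n l : ι → Type*}
    [∀ j, Fintype (l j)]
    (X : ∀ j, Matrix (m j) (l j) 𝕜) (Y : ∀ j, Matrix (n j) (l j) 𝕜) :
    tensorMatrix (fun j => X j * (Y j).transpose) =
      tensorMatrix X * (tensorMatrix Y).transpose := by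
  ext p q
  simp only [tensorMatrix, Matrix.mul_apply, Matrix.transpose_apply, Finset.prod_univ_sum,
    Fintype.piFinset_univ, Finset.prod_mul_distrib]

theorem sum_norm_sq_tensorMatrix {ι : Type*} [Fintype ι] [DecidableEq ι] {m n : ι → Type*}
    [∀ j, Fintype (m j)] [∀ j, Fintype (n j)] (A : ∀ j, Matrix (m j) (n j) 𝕜) :
    ∑ p, ∑ q, ‖tensorMatrix A p q‖ ^ 2 = ∏ j, ∑ a, ∑ b, ‖A j a b‖ ^ 2 := by
  simp only [tensorMatrix, norm_prod, ← Finset.prod_pow, Finset.prod_univ_sum,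
    Fintype.piFinset_univ]

/-- Split off the factor of index 0: it acts contractively for each fixed value of the other
indices, and the remaining factors do so for each fixed value of the index 0. -/
theorem isContraction_tensorMatrix {d : ℕ} {m n : Fin d → Type*} [∀ j, Fintype (m j)]
    [∀ j, Fintype (n j)] (X : ∀ j, Matrix (m j) (n j) 𝕜) (hX : ∀ j, IsContraction (X j)) :
    IsContraction (tensorMatrix X) := by
  induction d with
  | zero =>
    intro v
    simp [tensorMatrix, Matrix.mulVec, dotProduct]
  | succ d ih =>
    intro v
    have e1 := (Fin.consEquiv m).sum_comp fun p => ‖(tensorMatrix X).mulVec v p‖ ^ 2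
    have e2 := (Fin.consEquiv n).sum_comp fun p => ‖v p‖ ^ 2
    rw [← e1, ← e2, Fintype.sum_prod_type_right, Fintype.sum_prod_type]
    let X' : ∀ j : Fin d, Matrix (m j.succ) (n j.succ) 𝕜 := fun j => X j.succ
    let g (k : n 0) (p : ∀ j : Fin d, m j.succ) : 𝕜 :=
      (tensorMatrix X').mulVec (fun q => v (Fin.cons k q)) p
    calc ∑ p : ∀ j : Fin d, m j.succ, ∑ a : m 0,
          ‖(tensorMatrix X).mulVec v (Fin.consEquiv m (a, p))‖ ^ 2
        = ∑ p, ∑ a, ‖(X 0).mulVec (fun k => g k p) a‖ ^ 2 := by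
          refine Finset.sum_congr rfl fun p _ => Finset.sum_congr rfl fun a _ => ?_
          congr 2
          simp only [Matrix.mulVec, dotProduct, g, X', tensorMatrix, Fin.consEquiv]
          rw [← (Fin.consEquiv n).sum_comp, Fintype.sum_prod_type]
          refine Finset.sum_congr rfl fun k _ => ?_
          rw [Finset.mul_sum]
          refine Finset.sum_congr rfl fun q _ => ?_
          rw [Fin.prod_univ_succ]
          simp [Fin.consEquiv, mul_assoc]
      _ ≤ ∑ p, ∑ k, ‖g k p‖ ^ 2 := Finset.sum_le_sum fun p _ => hX 0 _
      _ = ∑ k, ∑ p, ‖g k p‖ ^ 2 := Finset.sum_comm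
      _ ≤ _ := Finset.sum_le_sum fun k _ => ih X' (fun j => hX _) _

end TensorMatrix

/-! ### The form associated with two families of signs -/

section SignForm

variable {𝕜 : Type*} [RCLike 𝕜] {d N : ℕ}

/-- The value of `⨂ j, A j` at the pair of sign tensors `ξ`, `η`. -/
def signForm (ξ η : (Fin d → Fin N) → ℤˣ) (A : Fin d → Matrix (Fin N) (Fin N) 𝕜) : 𝕜 :=
  ∑ p, ∑ q, ((ξ p : ℤ) : 𝕜) * ((η q : ℤ) : 𝕜) * tensorMatrix A p q

/-- `signForm` at the products `X j * (Y j)ᵀ`, as a multilinear map of all the factors. -/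
def signFormFactors (ξ η : (Fin d → Fin N) → ℤˣ) (S : Fin d → Type*) [∀ j, Fintype (S j)] :
    MultilinearMap 𝕜 (fun i : Fin d × Bool => Matrix (Fin N) (S i.1) 𝕜) 𝕜 :=
  ∑ p : Fin d → Fin N, ∑ q : Fin d → Fin N, ∑ k : ∀ j, S j, (((ξ p : ℤ) : 𝕜) * ((η q : ℤ) : 𝕜)) •
    (MultilinearMap.mkPiAlgebra 𝕜 (Fin d × Bool) 𝕜).compLinearMap fun i =>
      Matrix.entryLinearMap 𝕜 𝕜 (if i.2 then p i.1 else q i.1) (k i.1)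

theorem signFormFactors_apply (ξ η : (Fin d → Fin N) → ℤˣ) (S : Fin d → Type*)
    [∀ j, Fintype (S j)] (Z : ∀ i : Fin d × Bool, Matrix (Fin N) (S i.1) 𝕜) :
    signFormFactors ξ η S Z =
      signForm ξ η fun j => Z (j, true) * (Z (j, false)).transpose := by
  simp only [signFormFactors, signForm, sum_apply, smul_apply]
  refine Finset.sum_congr rfl fun p _ => Finset.sum_congr rfl fun q _ => ?_
  rw [← Finset.smul_sum, smul_eq_mul]
  congr 1
  rw [tensorMatrix_mul_transpose]
  simp only [Matrix.mul_apply, Matrix.transpose_apply, tensorMatrix]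
  refine Finset.sum_congr rfl fun k _ => ?_
  simp [Fintype.prod_prod_type, Finset.prod_mul_distrib]

end SignForm

/-! ### Union bound over nets and over ranks -/

section UnionBound

open Real

variable (𝕜 : Type*) [RCLike 𝕜] {d N : ℕ}

/-- Discretizing the factors rather than their products gives an entropy proportional to `N * r j`
instead of `N²`. Each of the `2 d` factors contributes at most `5 ^ (2 N r j) ≤ exp (4 N r j)`
points, and a factor 2 in the norm, whence `4 ^ d`. -/
theorem exists_net_factors (N : ℕ) (r : Fin d → ℕ) :
    ∃ K : Finset (∀ i : Fin d × Bool, Matrix (Fin N) (Fin (r i.1)) 𝕜),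
      (K.card : ℝ) ≤ exp (8 * N * ∑ j, (r j : ℝ)) ∧ (∀ Z ∈ K, ∀ i, IsContraction (Z i)) ∧
      ∀ (f : MultilinearMap 𝕜 (fun i : Fin d × Bool => Matrix (Fin N) (Fin (r i.1)) 𝕜) 𝕜) (T : ℝ),
        0 ≤ T → (∀ Z ∈ K, ‖f Z‖ ≤ T) →
          ∀ Z : ∀ i : Fin d × Bool, Matrix (Fin N) (Fin (r i.1)) 𝕜,
            (∀ i, IsContraction (Z i)) → ‖f Z‖ ≤ 4 ^ d * T := by
  classical
  choose K hcard hK hnet using fun k : ℕ => exists_finset_contraction 𝕜 (Fin N) (Fin k)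
  refine ⟨Fintype.piFinset fun i : Fin d × Bool => K (r i.1), ?_, ?_, ?_⟩
  · rw [Fintype.card_piFinset, Fintype.prod_prod_type]
    simp only [Fintype.prod_bool, Nat.cast_prod, Nat.cast_mul, Finset.mul_sum, exp_sum]
    refine Finset.prod_le_prod (fun j _ => by positivity) fun j _ => ?_
    have h5 : (5 : ℝ) ≤ exp 2 := by
      have h := exp_one_gt_d9
      have h2 : exp 2 = exp 1 ^ 2 := by rw [← exp_nat_mul]; norm_num
      rw [h2]
      nlinarith
    have h1 : ((K (r j)).card : ℝ) ≤ exp (4 * N * r j) := by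
      have h := hcard (r j)
      rw [Fintype.card_fin, Fintype.card_fin] at h
      calc ((K (r j)).card : ℝ) ≤ 5 ^ (2 * (N * r j)) := by exact_mod_cast h
        _ ≤ exp 2 ^ (2 * (N * r j)) := by gcongr
        _ = _ := by
          rw [← exp_nat_mul]
          push_cast
          ring_nf
    calc ((K (r j)).card : ℝ) * (K (r j)).card
        ≤ exp (4 * N * r j) * exp (4 * N * r j) := by gcongr
      _ = _ := by rw [← exp_add]; ring_nf
  · intro Z hZ i
    exact hK _ _ (Fintype.mem_piFinset.mp hZ i)
  · intro f T hT hf Z hZ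
    have := MultilinearMap.norm_le_two_pow_mul (fun i : Fin d × Bool => K (r i.1))
      (fun i => {X | IsContraction X}) (fun i f T hT hf x hx => hnet _ f T hT hf x hx) f hT
      (fun x hx => hf x (Fintype.mem_piFinset.mpr hx)) Z hZ
    rw [Fintype.card_prod, Fintype.card_fin, Fintype.card_bool, mul_comm d, pow_mul] at this
    norm_num at this
    exact this

/-- The constant in the estimate of the sign form. -/
noncomputable def signConst (d : ℕ) : ℝ := 4 ^ d * (2 * (18 * d + 5))

theorem signConst_nonneg (d : ℕ) : 0 ≤ signConst d := by unfold signConst; positivity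

theorem card_bad_signs_le (N : ℕ) (hN : 1 ≤ N) (r : Fin d → ℕ) (hrN : ∀ j, r j ≤ N)
    (hr : ∀ j, r j ^ 2 ≤ ∏ i, r i) :
    ∃ bad : Finset (((Fin d → Fin N) → ℤˣ) × ((Fin d → Fin N) → ℤˣ)),
      (bad.card : ℝ) ≤ 4 * (2 ^ Fintype.card (Fin d → Fin N) * 2 ^ Fintype.card (Fin d → Fin N) *
        exp (-((d + 2) * N))) ∧
      ∀ ε ∉ bad, ∀ X Y : ∀ j, Matrix (Fin N) (Fin (r j)) 𝕜, (∀ j, IsContraction (X j)) →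
        (∀ j, IsContraction (Y j)) →
        ‖signForm ε.1 ε.2 fun j => X j * (Y j).transpose‖ ≤
          signConst d * (N * √(∏ j, (r j : ℝ))) := by
  classical
  -- A zero rank makes the form vanish; otherwise `R ≥ 1`, which the choice of parameters needs.
  by_cases h0 : ∃ j, r j = 0
  · obtain ⟨j, hj⟩ := h0
    refine ⟨∅, by simp only [Finset.card_empty, Nat.cast_zero]; positivity,
      fun ε _ X Y _ _ => ?_⟩
    have hz : X j * (Y j).transpose = 0 := by
      have : IsEmpty (Fin (r j)) := by rw [hj]; infer_instance
      ext a b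
      simp [Matrix.mul_apply]
    have : signForm ε.1 ε.2 (fun j => X j * (Y j).transpose) = 0 := by
      refine Finset.sum_eq_zero fun p _ => Finset.sum_eq_zero fun q _ => ?_
      rw [tensorMatrix, Finset.prod_eq_zero (Finset.mem_univ j) (by rw [hz]; rfl), mul_zero]
    rw [this, norm_zero]
    have := signConst_nonneg d
    positivity
  push Not at h0
  obtain ⟨K, hcard, hK, hnet⟩ := exists_net_factors 𝕜 N r
  set R : ℝ := ∏ j, (r j : ℝ) with hR
  have hr1 (j) : (1 : ℝ) ≤ r j := by exact_mod_cast Nat.one_le_iff_ne_zero.mpr (h0 j)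
  have hR1 : 1 ≤ R := by
    rw [hR, ← Nat.cast_prod]
    exact_mod_cast Nat.one_le_iff_ne_zero.mpr (Finset.prod_ne_zero_iff.mpr fun j _ => h0 j)
  have hsR1 : 1 ≤ √R := one_le_sqrt.mpr hR1
  have hsR : √R ^ 2 = R := sq_sqrt (by linarith)
  have hN' : (1 : ℝ) ≤ N := by exact_mod_cast hN
  -- `μ` bounds every `r j`, so the net has at most `exp (8 d N μ)` points. This is where `r j ^ 2 ≤
  -- R` enters.
  set μ : ℝ := min N √R with hμ
  have hμ1 : 1 ≤ μ := le_min hN' hsR1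
  have hrμ (j) : (r j : ℝ) ≤ μ := by
    refine le_min (by exact_mod_cast hrN j) (le_sqrt_of_sq_le ?_)
    rw [hR]
    exact_mod_cast hr j
  -- With `t = μ / (2 √R) ≤ 1 / 2`, one has `t² R = μ² / 4 ≤ N μ / 4` and `t T = (9 d + 5 / 2) N μ`.
  -- This beats the entropy `8 d N μ` and leaves at least `(d + 2) N` in the exponent.
  set T : ℝ := (18 * d + 5) * (N * √R) with hT
  have hT0 : 0 ≤ T := by positivity
  set t : ℝ := μ / (2 * √R) with ht
  have ht2 : t ≤ 1 / 2 := by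
    rw [ht, div_le_iff₀ (by positivity)]
    linarith [min_le_right (N : ℝ) √R]
  let M := fun Z : ∀ i : Fin d × Bool, Matrix (Fin N) (Fin (r i.1)) 𝕜 =>
    tensorMatrix fun j => Z (j, true) * (Z (j, false)).transpose
  let badZ := fun Z : ∀ i : Fin d × Bool, Matrix (Fin N) (Fin (r i.1)) 𝕜 =>
    ({ε | 2 * T < ‖∑ p, ∑ q, (((ε.1 p : ℤ) : 𝕜) * ((ε.2 q : ℤ) : 𝕜) * M Z p q)‖} :
      Finset (((Fin d → Fin N) → ℤˣ) × ((Fin d → Fin N) → ℤˣ)))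
  have hbadZ (Z) (hZ : Z ∈ K) : ((badZ Z).card : ℝ) ≤ 4 * (2 ^ Fintype.card (Fin d → Fin N) *
      2 ^ Fintype.card (Fin d → Fin N) * exp (t ^ 2 * R - t * T)) := by
    have hc (j) : IsContraction (Z (j, true) * (Z (j, false)).transpose) :=
      (hK Z hZ _).mul (hK Z hZ _).transpose
    refine (card_norm_bilinear_rademacher_gt_le (isContraction_tensorMatrix _ hc)
      (by positivity) ht2).trans ?_
    gcongr
    rw [sum_norm_sq_tensorMatrix]
    refine Finset.prod_le_prod (fun j _ => by positivity) fun j _ => ?_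
    refine (sum_norm_sq_mul_le (hK Z hZ _) _).trans ?_
    have h1 := (hK Z hZ (j, false)).sum_norm_sq_le
    rw [Finset.sum_comm] at h1
    exact h1.trans_eq (by simp)
  refine ⟨K.biUnion badZ, ?_, ?_⟩
  · calc ((K.biUnion badZ).card : ℝ) ≤ ∑ Z ∈ K, ((badZ Z).card : ℝ) := by
          exact_mod_cast Finset.card_biUnion_le
      _ ≤ K.card * (4 * (2 ^ Fintype.card (Fin d → Fin N) *
            2 ^ Fintype.card (Fin d → Fin N) * exp (t ^ 2 * R - t * T))) := by
          rw [← nsmul_eq_mul]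
          exact Finset.sum_le_card_nsmul _ _ _ hbadZ
      _ ≤ exp (8 * N * ∑ j, (r j : ℝ)) * (4 * (2 ^ Fintype.card (Fin d → Fin N) *
            2 ^ Fintype.card (Fin d → Fin N) * exp (t ^ 2 * R - t * T))) := by gcongr
      _ = 4 * (2 ^ Fintype.card (Fin d → Fin N) * 2 ^ Fintype.card (Fin d → Fin N) *
            exp (8 * N * ∑ j, (r j : ℝ) + (t ^ 2 * R - t * T))) := by rw [exp_add]; ring
      _ ≤ _ := by
          gcongr
          have hsum : ∑ j, (r j : ℝ) ≤ d * μ := by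
            refine (Finset.sum_le_sum fun j _ => hrμ j).trans_eq ?_
            simp
          have h1 : t ^ 2 * R = μ ^ 2 / 4 := by
            rw [ht, div_pow, mul_pow, hsR]
            field_simp
            norm_num
          have h2 : t * T = (18 * d + 5) * (N * μ) / 2 := by
            rw [ht, hT]
            field_simp
          have h3 : μ ^ 2 ≤ N * μ := by
            rw [sq]
            gcongr
            exact min_le_left _ _
          have h4 : (N : ℝ) ≤ N * μ := le_mul_of_one_le_right (by positivity) hμ1
          have h5 : 8 * N * ∑ j, (r j : ℝ) ≤ 8 * N * (d * μ) := by gcongr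
          have h6 : (d : ℝ) * N ≤ d * (N * μ) := by gcongr
          rw [h1, h2]
          nlinarith
  · intro ε hε X Y hX hY
    have h := hnet (signFormFactors ε.1 ε.2 fun j => Fin (r j)) (2 * T) (by positivity) ?_
      (fun i => if i.2 then X i.1 else Y i.1) ?_
    · rw [signFormFactors_apply] at h
      refine h.trans_eq ?_
      rw [hT, signConst]
      ring
    · intro Z hZ
      rw [signFormFactors_apply]
      by_contra! hcon
      exact hε (Finset.mem_biUnion.mpr ⟨Z, hZ, Finset.mem_filter.mpr ⟨Finset.mem_univ _, hcon⟩⟩)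
    · rintro ⟨j, b⟩
      cases b
      · exact hY j
      · exact hX j

theorem exists_signs_of_sq_le (N : ℕ) (hN : 1 ≤ N) :
    ∃ ξ η : (Fin d → Fin N) → ℤˣ, ∀ r : Fin d → ℕ, (∀ j, r j ≤ N) → (∀ j, r j ^ 2 ≤ ∏ i, r i) →
      ∀ X Y : ∀ j, Matrix (Fin N) (Fin (r j)) 𝕜, (∀ j, IsContraction (X j)) →
        (∀ j, IsContraction (Y j)) →
        ‖signForm ξ η fun j => X j * (Y j).transpose‖ ≤
          signConst d * (N * √(∏ j, (r j : ℝ))) := by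
  classical
  choose! bad hcard hbad using fun r : Fin d → ℕ => card_bad_signs_le 𝕜 N hN r
  let good : Finset (Fin d → Fin (N + 1)) := {r | ∀ j, (r j : ℕ) ^ 2 ≤ ∏ i, (r i : ℕ)}
  have hlt (r : Fin d → Fin (N + 1)) (j) : (r j : ℕ) ≤ N := Nat.lt_succ_iff.mp (r j).2
  have hex : ∃ ε : ((Fin d → Fin N) → ℤˣ) × ((Fin d → Fin N) → ℤˣ),
      ε ∉ good.biUnion fun r => bad fun j => r j := by
    by_contra! hall
    have huniv : (good.biUnion fun r => bad fun j => r j) = Finset.univ := by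
      ext ε
      simpa using! hall ε
    have h1 : ((2 : ℝ) ^ Fintype.card (Fin d → Fin N) * 2 ^ Fintype.card (Fin d → Fin N)) ≤
        ∑ r ∈ good, ((bad fun j => r j).card : ℝ) := by
      have := Finset.card_biUnion_le (s := good) (t := fun r => bad fun j => (r j : ℕ))
      rw [huniv, Finset.card_univ, Fintype.card_prod, Fintype.card_fun, Fintype.card_units_int]
        at this
      exact_mod_cast this
    have h2 : ∑ r ∈ good, ((bad fun j => r j).card : ℝ) ≤ (N + 1 : ℝ) ^ d *
        (4 * (2 ^ Fintype.card (Fin d → Fin N) * 2 ^ Fintype.card (Fin d → Fin N) *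
        exp (-((d + 2) * N)))) := by
      refine (Finset.sum_le_card_nsmul _ _ _ fun r hr => hcard (fun j => r j) (hlt r)
        (Finset.mem_filter.mp hr).2).trans ?_
      rw [nsmul_eq_mul]
      gcongr
      have := Finset.card_le_univ good
      rw [Fintype.card_fun, Fintype.card_fin, Fintype.card_fin] at this
      exact_mod_cast this
    -- In the exponent `(d + 2) N`, the part `d N` absorbs the at most `(N + 1) ^ d` rank vectors
    -- and `2 N` absorbs the factor 4.
    have h3 : (N + 1 : ℝ) ^ d * (4 * exp (-((d + 2) * N))) < 1 := by
      have hN' : (1 : ℝ) ≤ N := by exact_mod_cast hN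
      calc (N + 1 : ℝ) ^ d * (4 * exp (-((d + 2) * N)))
          ≤ exp N ^ d * (4 * exp (-((d + 2) * N))) := by
            gcongr
            exact add_one_le_exp _
        _ = 4 * exp (-(2 * N)) := by
            rw [← exp_nat_mul, mul_left_comm, ← exp_add]
            ring_nf
        _ ≤ 4 * exp (-2) := by gcongr; linarith
        _ < 1 := by
            rw [exp_neg, ← div_eq_mul_inv, div_lt_one (exp_pos _)]
            have h := exp_one_gt_d9
            have h2 : exp 2 = exp 1 ^ 2 := by rw [← exp_nat_mul]; norm_num
            rw [h2]
            nlinarith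
    have h4 := h1.trans h2
    have h5 : (0 : ℝ) < 2 ^ Fintype.card (Fin d → Fin N) * 2 ^ Fintype.card (Fin d → Fin N) := by
      positivity
    nlinarith
  obtain ⟨ε, hε⟩ := hex
  refine ⟨ε.1, ε.2, fun r hrN hr => hbad r hrN hr ε fun hmem => hε ?_⟩
  exact Finset.mem_biUnion.mpr ⟨fun j => ⟨r j, Nat.lt_succ_of_le (hrN j)⟩,
    Finset.mem_filter.mpr ⟨Finset.mem_univ _, hr⟩, hmem⟩

end UnionBound

/-! ### Compression of a factor of too large rank -/

section Compression

variable {𝕜 : Type*} [RCLike 𝕜]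

theorem isContraction_of_orthogonal {m n : Type*} [Fintype m] [Fintype n]
    (x : n → EuclideanSpace 𝕜 m) (hx : ∀ i j, i ≠ j → inner 𝕜 (x i) (x j) = 0)
    (hx1 : ∀ i, ‖x i‖ ≤ 1) : IsContraction (Matrix.of fun a k => x k a) := by
  intro v
  have h := norm_sq_sum_smul_of_orthogonal x hx v
  rw [EuclideanSpace.norm_sq_eq] at h
  refine (le_of_eq ?_).trans (h.trans_le ?_)
  · refine Finset.sum_congr rfl fun a _ => ?_
    simp [Matrix.mulVec, dotProduct, mul_comm]
  · refine Finset.sum_le_sum fun k _ => mul_le_of_le_one_right (by positivity) ?_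
    exact pow_le_one₀ (norm_nonneg _) (hx1 k)

theorem IsContraction.map_star {m n : Type*} [Fintype m] [Fintype n] {X : Matrix m n 𝕜}
    (hX : IsContraction X) : IsContraction (X.map star) := by
  intro v
  have h := hX fun k => star (v k)
  simp only [norm_star] at h
  refine (le_of_eq ?_).trans h
  refine Finset.sum_congr rfl fun p _ => ?_
  rw [← norm_star]
  congr 2
  simp [Matrix.mulVec, dotProduct]

theorem IsContraction.submatrix_equiv {m n l : Type*} [Fintype m] [Fintype n] [Fintype l]
    {X : Matrix m n 𝕜} (hX : IsContraction X) (e : l ≃ n) : IsContraction (X.submatrix id e) := by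
  intro v
  have h := hX fun k => v (e.symm k)
  rw [e.symm.sum_comp fun k => ‖v k‖ ^ 2] at h
  refine (le_of_eq ?_).trans h
  refine Finset.sum_congr rfl fun p _ => ?_
  congr 2
  simp only [Matrix.mulVec, dotProduct, Matrix.submatrix_apply, id]
  rw [← e.sum_comp]
  simp

/-- Every matrix with columns indexed by `Fin s` is fixed by `P * Pᴴ`, for some contraction `P`
of the same format. -/
theorem exists_contraction_mul_conjTranspose_mul {m : Type*} [Fintype m] {s : ℕ}
    (U : Matrix m (Fin s) 𝕜) :
    ∃ P : Matrix m (Fin s) 𝕜, IsContraction P ∧ P * (P.conjTranspose * U) = U := by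
  let f : Fin s → EuclideanSpace 𝕜 m := fun k => WithLp.toLp 2 fun a => U a k
  let g : Fin s → EuclideanSpace 𝕜 m := InnerProductSpace.gramSchmidtNormed 𝕜 f
  have horth (i j) (hij : i ≠ j) : inner 𝕜 (g i) (g j) = 0 := by
    simp only [g, InnerProductSpace.gramSchmidtNormed, inner_smul_left, inner_smul_right,
      InnerProductSpace.gramSchmidt_orthogonal 𝕜 f hij, mul_zero]
  -- Linearly dependent columns produce zero vectors, so `P` is only a partial isometry; `P * Pᴴ` is
  -- still the projection onto the span of the columns.
  have hnorm (i) : g i = 0 ∨ ‖g i‖ = 1 :=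
    or_iff_not_imp_left.mpr InnerProductSpace.gramSchmidtNormed_unit_length'
  have hspan (k) : f k ∈ Submodule.span 𝕜 (Set.range g) := by
    rw [InnerProductSpace.span_gramSchmidtNormed_range, InnerProductSpace.span_gramSchmidt]
    exact Submodule.subset_span ⟨k, rfl⟩
  have hproj (k) : ∑ i, inner 𝕜 (g i) (f k) • g i = f k := by
    obtain ⟨c, hc⟩ := (Submodule.mem_span_range_iff_exists_fun 𝕜).mp (hspan k)
    rw [← hc]
    refine Finset.sum_congr rfl fun i _ => ?_
    rw [inner_sum, Finset.sum_eq_single i]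
    · rcases hnorm i with h | h
      · simp [h]
      · rw [inner_smul_right, inner_self_eq_norm_sq_to_K, h]
        simp
    · intro j _ hj
      rw [inner_smul_right, horth i j hj.symm, mul_zero]
    · simp
  refine ⟨Matrix.of fun a k => g k a, isContraction_of_orthogonal g horth fun i => ?_, ?_⟩
  · rcases hnorm i with h | h <;> simp [h]
  · ext a k
    have h := congrArg (fun x : EuclideanSpace 𝕜 m => x a) (hproj k)
    simp only [PiLp.inner_apply, RCLike.inner_apply] at h
    simp only [Matrix.mul_apply, Matrix.conjTranspose_apply, Matrix.of_apply]
    refine Eq.trans ?_ h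
    rw [WithLp.ofLp_sum, Finset.sum_apply]
    refine Finset.sum_congr rfl fun i _ => ?_
    rw [PiLp.smul_apply, smul_eq_mul, mul_comm]
    congr 1
    refine Finset.sum_congr rfl fun b _ => ?_
    rw [mul_comm]
    rfl

variable {d N : ℕ}

/-- Expanding the products `X j * (Y j)ᵀ` for `j ≠ j₀` over their inner indices writes the form as a
sum of `∏_{j ≠ j₀} r j` terms, each of the form `uᵀ C w`. The vectors `u` and `w` are the columns of
`U` and `W`. -/
theorem exists_signForm_update_eq_trace (ξ η : (Fin d → Fin N) → ℤˣ) (r : Fin d → ℕ)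
    (X Y : ∀ j, Matrix (Fin N) (Fin (r j)) 𝕜) (j₀ : Fin d) :
    ∃ U W : Matrix (Fin N) (Fin (∏ j ∈ Finset.univ.erase j₀, r j)) 𝕜,
      ∀ C : Matrix (Fin N) (Fin N) 𝕜,
        signForm ξ η (Function.update (fun j => X j * (Y j).transpose) j₀ C) =
          (U.transpose * C * W).trace := by
  classical
  let κ := ∀ j : {j // j ≠ j₀}, Fin (r j)
  have hcard : Fintype.card κ = ∏ j ∈ Finset.univ.erase j₀, r j := by
    simp only [κ, Fintype.card_pi, Fintype.card_fin]
    exact (Finset.prod_subtype (p := fun j => j ≠ j₀) _ (by simp) fun j => r j).symm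
  let e : Fin (∏ j ∈ Finset.univ.erase j₀, r j) ≃ κ := (Fintype.equivFinOfCardEq hcard).symm
  let u (ε : (Fin d → Fin N) → ℤˣ) (Z : ∀ j, Matrix (Fin N) (Fin (r j)) 𝕜) : Matrix (Fin N) κ 𝕜 :=
    fun a k => ∑ p, if p j₀ = a then ((ε p : ℤ) : 𝕜) * ∏ j : {j // j ≠ j₀}, Z j (p j) (k j) else 0
  refine ⟨(u ξ X).submatrix id e, (u η Y).submatrix id e, fun C => ?_⟩
  have htensor (p q : Fin d → Fin N) :
      tensorMatrix (Function.update (fun j => X j * (Y j).transpose) j₀ C) p q =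
        ∑ k : κ, C (p j₀) (q j₀) * ((∏ j : {j // j ≠ j₀}, X j (p j) (k j)) *
          ∏ j : {j // j ≠ j₀}, Y j (q j) (k j)) := by
    rw [tensorMatrix, ← Finset.mul_prod_erase _ _ (Finset.mem_univ j₀), Function.update_self,
      ← Finset.mul_sum]
    congr 1
    rw [Finset.prod_subtype (p := fun j => j ≠ j₀) _ (by simp)]
    calc _ = ∏ j : {j // j ≠ j₀}, ∑ k, X j (p j) k * Y j (q j) k := by
          refine Finset.prod_congr rfl fun j _ => ?_
          rw [Function.update_of_ne j.2]
          rfl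
      _ = _ := by
          rw [Finset.prod_univ_sum, Fintype.piFinset_univ]
          simp only [Finset.prod_mul_distrib, κ]
  have htrace : (((u ξ X).submatrix id e).transpose * C * (u η Y).submatrix id e).trace =
      ∑ k : κ, ∑ b, ∑ a, u ξ X a k * C a b * u η Y b k := by
    simp only [Matrix.trace, Matrix.diag, Matrix.mul_apply, Matrix.transpose_apply,
      Matrix.submatrix_apply, id, Finset.sum_mul]
    exact e.sum_comp fun k => ∑ b, ∑ a, u ξ X a k * C a b * u η Y b k
  rw [htrace, signForm]
  simp only [htensor, Finset.mul_sum]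
  rw [Finset.sum_congr rfl fun p _ => Finset.sum_comm, Finset.sum_comm]
  refine Finset.sum_congr rfl fun k _ => ?_
  have hfiber (x : (Fin d → Fin N) → 𝕜) (g : Fin N → 𝕜) :
      ∑ a, (∑ p, if p j₀ = a then x p else 0) * g a = ∑ p, x p * g (p j₀) := by
    simp_rw [Finset.sum_mul, ite_mul, zero_mul]
    rw [Finset.sum_comm]
    simp
  simp only [u, mul_assoc (∑ p : Fin d → Fin N, _), hfiber]
  refine Eq.trans ?_ Finset.sum_comm
  refine Finset.sum_congr rfl fun p _ => ?_
  rw [← Finset.mul_sum]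
  simp_rw [mul_comm (C _ _)]
  rw [hfiber, Finset.mul_sum]
  refine Finset.sum_congr rfl fun q _ => ?_
  ring

/-- Being a product `X * Yᵀ` of contractions through a space of dimension `r`. -/
def FactorsThrough (r : ℕ) (A : Matrix (Fin N) (Fin N) 𝕜) : Prop :=
  ∃ X Y : Matrix (Fin N) (Fin r) 𝕜, IsContraction X ∧ IsContraction Y ∧ A = X * Y.transpose

theorem IsContraction.factorsThrough_card {S : Type*} [Fintype S] {X Y : Matrix (Fin N) S 𝕜}
    (hX : IsContraction X) (hY : IsContraction Y) :
    FactorsThrough (Fintype.card S) (X * Y.transpose) := by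
  let e := (Fintype.equivFin S).symm
  refine ⟨X.submatrix id e, Y.submatrix id e, hX.submatrix_equiv e, hY.submatrix_equiv e, ?_⟩
  rw [Matrix.transpose_submatrix, Matrix.submatrix_mul_equiv]
  rfl

theorem exists_compression (ξ η : (Fin d → Fin N) → ℤˣ) (r : Fin d → ℕ)
    (A : Fin d → Matrix (Fin N) (Fin N) 𝕜) (hA : ∀ j, FactorsThrough (r j) (A j)) (j₀ : Fin d) :
    ∃ C : Matrix (Fin N) (Fin N) 𝕜, FactorsThrough (∏ j ∈ Finset.univ.erase j₀, r j) C ∧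
      signForm ξ η (Function.update A j₀ C) = signForm ξ η A := by
  choose X Y hX hY hXY using hA
  obtain ⟨U, W, hUW⟩ := exists_signForm_update_eq_trace ξ η r X Y j₀
  obtain ⟨P, hP, hPU⟩ := exists_contraction_mul_conjTranspose_mul U
  have hA : A = fun j => X j * (Y j).transpose := funext hXY
  have hc : IsContraction (A j₀) := by
    rw [hXY]
    exact (hX j₀).mul (hY j₀).transpose
  -- This is `P̄ Pᵀ A`, with `A` the factor at `j₀`. Since `Uᵀ P̄ Pᵀ = (P Pᴴ U)ᵀ = Uᵀ`, the trace is
  -- unchanged.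
  refine ⟨P.map star * ((A j₀).transpose * P).transpose,
    ⟨_, _, hP.map_star, hc.transpose.mul hP, rfl⟩, ?_⟩
  conv_rhs => rw [← Function.update_eq_self j₀ A]
  rw [hA, hUW, hUW, ← hA]
  congr 2
  conv_rhs => rw [← hPU]
  simp only [Matrix.transpose_mul, Matrix.transpose_transpose, ← Matrix.mul_assoc]
  rfl

theorem signForm_eq_zero_of_factorsThrough_zero (ξ η : (Fin d → Fin N) → ℤˣ)
    (A : Fin d → Matrix (Fin N) (Fin N) 𝕜) (j : Fin d) (hA : FactorsThrough 0 (A j)) :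
    signForm ξ η A = 0 := by
  obtain ⟨X, Y, -, -, h⟩ := hA
  refine Finset.sum_eq_zero fun p _ => Finset.sum_eq_zero fun q _ => ?_
  rw [tensorMatrix, Finset.prod_eq_zero (Finset.mem_univ j) (by simp [h, Matrix.mul_apply]),
    mul_zero]

variable (𝕜) in
theorem exists_signs (N : ℕ) (hN : 1 ≤ N) :
    ∃ ξ η : (Fin d → Fin N) → ℤˣ, ∀ r : Fin d → ℕ, (∀ j, r j ≤ N) →
      ∀ A : Fin d → Matrix (Fin N) (Fin N) 𝕜, (∀ j, FactorsThrough (r j) (A j)) →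
        ‖signForm ξ η A‖ ≤ signConst d * (N * √(∏ j, (r j : ℝ))) := by
  obtain ⟨ξ, η, h⟩ := exists_signs_of_sq_le 𝕜 N hN
  have h' (r : Fin d → ℕ) (hrN : ∀ j, r j ≤ N) (hr : ∀ j, r j ^ 2 ≤ ∏ i, r i)
      (A : Fin d → Matrix (Fin N) (Fin N) 𝕜) (hA : ∀ j, FactorsThrough (r j) (A j)) :
      ‖signForm ξ η A‖ ≤ signConst d * (N * √(∏ j, (r j : ℝ))) := by
    choose X Y hX hY hXY using hA
    rw [funext hXY]
    exact h r hrN hr X Y hX hY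
  refine ⟨ξ, η, fun r hrN A hA => ?_⟩
  by_cases hr : ∀ j, r j ^ 2 ≤ ∏ i, r i
  · exact h' r hrN hr A hA
  by_cases h0 : ∃ j, r j = 0
  · obtain ⟨j, hj⟩ := h0
    rw [signForm_eq_zero_of_factorsThrough_zero ξ η A j (hj ▸ hA j), norm_zero]
    have := signConst_nonneg d
    positivity
  push Not at hr h0
  obtain ⟨j₀, hj₀⟩ := hr
  rw [← Finset.mul_prod_erase _ _ (Finset.mem_univ j₀), sq] at hj₀
  have hlt := lt_of_mul_lt_mul_left' hj₀
  obtain ⟨C, hC, hCA⟩ := exists_compression ξ η r A hA j₀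
  set ρ := ∏ j ∈ Finset.univ.erase j₀, r j with hρ
  -- After the compression all ranks are at most `ρ` and their product is `ρ²`, so the condition on
  -- squares holds; as `ρ < r j₀`, the bound obtained is no larger than the one required.
  have hprod : ∏ i, Function.update r j₀ ρ i = ρ * ρ := by
    rw [← Finset.mul_prod_erase _ _ (Finset.mem_univ j₀), Function.update_self]
    congr 1
    refine Finset.prod_congr rfl fun j hj => ?_
    rw [Function.update_of_ne (Finset.ne_of_mem_erase hj)]
  have hle (j) : Function.update r j₀ ρ j ≤ ρ := by
    by_cases hj : j = j₀
    · subst hj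
      simp
    · rw [Function.update_of_ne hj]
      exact Finset.single_le_prod' (f := r)
        (fun i _ => Nat.one_le_iff_ne_zero.mpr (h0 i)) (Finset.mem_erase.mpr ⟨hj, Finset.mem_univ j⟩)
  rw [← hCA]
  refine (h' (Function.update r j₀ ρ) (fun j => (hle j).trans (hlt.le.trans (hrN j₀)))
    (fun j => ?_) _ fun j => ?_).trans ?_
  · rw [hprod, sq]
    exact Nat.mul_le_mul (hle j) (hle j)
  · by_cases hj : j = j₀
    · subst hj
      simpa using hC
    · rw [Function.update_of_ne hj, Function.update_of_ne hj]
      exact hA j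
  · have := signConst_nonneg d
    gcongr _ * (_ * √?_)
    rw [← Nat.cast_prod, ← Nat.cast_prod, hprod, ← Finset.mul_prod_erase _ _ (Finset.mem_univ j₀)]
    exact_mod_cast Nat.mul_le_mul_right ρ hlt.le

end Compression

/-! ### Dyadic levels of singular values -/

section Levels

variable {𝕜 : Type*} [RCLike 𝕜] {d N : ℕ}

/-- A matrix of Hilbert-Schmidt norm at most one is decomposed along the dyadic level sets of its
singular values. -/
theorem exists_dyadic_decomposition (A : Matrix (Fin N) (Fin N) 𝕜)
    (hA : ∑ a, ∑ b, ‖A a b‖ ^ 2 ≤ 1) (L : ℕ) (hL : N ≤ 4 ^ L) :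
    ∃ (r : Fin (L + 1) → ℕ) (B : Fin (L + 1) → Matrix (Fin N) (Fin N) 𝕜),
      (∀ k, r k ≤ N) ∧ (∀ k, FactorsThrough (r k) (B k)) ∧
      A = ∑ k : Fin (L + 1), (((2⁻¹ : ℝ) ^ (k : ℕ) : ℝ) : 𝕜) • B k ∧
      ∑ k : Fin (L + 1), (2⁻¹ : ℝ) ^ (k : ℕ) * √(r k) ≤ √(5 * (L + 1)) := by
  let T : EuclideanSpace 𝕜 (Fin N) →ₗ[𝕜] EuclideanSpace 𝕜 (Fin N) := Matrix.toEuclideanLin A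
  obtain ⟨v, hv⟩ := exists_orthonormalBasis_map_orthogonal T (finrank_euclideanSpace_fin (n := N))
  have hTe (b a : Fin N) : T (EuclideanSpace.single b 1) a = A a b := by
    simp [T, Matrix.toEuclideanLin, Matrix.mulVec, dotProduct, Pi.single_apply]
  have hHS : ∑ i, ‖T (v i)‖ ^ 2 ≤ 1 := by
    rw [sum_norm_sq_map_orthonormalBasis_eq T v (EuclideanSpace.basisFun (Fin N) 𝕜)]
    refine (le_of_eq ?_).trans hA
    rw [Finset.sum_comm]
    refine Finset.sum_congr rfl fun b _ => ?_
    rw [EuclideanSpace.norm_sq_eq]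
    simp [hTe]
  have hentry (a b : Fin N) : A a b = ∑ i, T (v i) a * star (v i b) := by
    rw [← hTe]
    conv_lhs => rw [← v.sum_repr' (EuclideanSpace.single b 1), map_sum]
    rw [WithLp.ofLp_sum, Finset.sum_apply]
    refine Finset.sum_congr rfl fun i _ => ?_
    rw [map_smul, PiLp.smul_apply, smul_eq_mul, mul_comm, EuclideanSpace.inner_single_right]
    simp
  have hσ1 (i) : ‖T (v i)‖ ≤ 1 := by
    have := (Finset.single_le_sum (f := fun i => ‖T (v i)‖ ^ 2) (fun i _ => by positivity)
      (Finset.mem_univ i)).trans hHS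
    exact (sq_le_one_iff₀ (norm_nonneg _)).mp this
  -- The search is capped at `L`, so all the smallest singular values share the last level. There `4
  -- ^ (-L) ≤ 1 / N`, which is the extra term in `hlev'`; over `N` indices it adds at most 1 to the
  -- sum `4 ∑ ‖T (v i)‖² ≤ 4`.
  let lev (i : Fin N) : ℕ := Nat.findGreatest (fun k => ‖T (v i)‖ ≤ (2⁻¹ : ℝ) ^ k) L
  have hlevL (i) : lev i ≤ L := Nat.findGreatest_le L
  have hlev (i) : ‖T (v i)‖ ≤ (2⁻¹ : ℝ) ^ lev i :=
    Nat.findGreatest_spec (P := fun k => ‖T (v i)‖ ≤ (2⁻¹ : ℝ) ^ k) (Nat.zero_le L)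
      (by simpa using hσ1 i)
  have hlev' (i) : ((2⁻¹ : ℝ) ^ lev i) ^ 2 ≤ 4 * ‖T (v i)‖ ^ 2 + (N : ℝ)⁻¹ := by
    have hN : (0 : ℝ) < N := by exact_mod_cast i.pos
    rcases (hlevL i).eq_or_lt with h | h
    · have : ((2⁻¹ : ℝ) ^ lev i) ^ 2 ≤ (N : ℝ)⁻¹ := by
        rw [h, ← pow_mul, mul_comm, pow_mul, le_inv_comm₀ (by positivity) hN, ← inv_pow]
        norm_num
        exact_mod_cast hL
      nlinarith [sq_nonneg ‖T (v i)‖]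
    · have h1 : (2⁻¹ : ℝ) ^ (lev i + 1) < ‖T (v i)‖ := not_le.mp
        (Nat.findGreatest_is_greatest (P := fun k => ‖T (v i)‖ ≤ (2⁻¹ : ℝ) ^ k)
          (Nat.lt_succ_self _) h)
      rw [pow_succ] at h1
      have h2 : (0 : ℝ) < 2⁻¹ ^ lev i := by positivity
      have h3 : (0 : ℝ) < (N : ℝ)⁻¹ := by positivity
      nlinarith
  let ℓ (i : Fin N) : Fin (L + 1) := ⟨lev i, Nat.lt_succ_of_le (hlevL i)⟩
  let X (k : Fin (L + 1)) : Matrix (Fin N) {i // ℓ i = k} 𝕜 :=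
    Matrix.of fun a i => (((2 : ℝ) ^ (k : ℕ) : ℝ) : 𝕜) • T (v i) |>.ofLp a
  let Y (k : Fin (L + 1)) : Matrix (Fin N) {i // ℓ i = k} 𝕜 := Matrix.of fun b i => v i b
  have hX (k) : IsContraction (X k) := by
    refine isContraction_of_orthogonal (fun i : {i // ℓ i = k} =>
      (((2 : ℝ) ^ (k : ℕ) : ℝ) : 𝕜) • T (v i)) (fun i j hij => ?_) fun i => ?_
    · rw [inner_smul_left, inner_smul_right, hv i j (fun h => hij (Subtype.ext h)), mul_zero,
        mul_zero]
    · have h := hlev i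
      have hk : lev i = k := congrArg Fin.val i.2
      rw [hk] at h
      rw [norm_smul, RCLike.norm_ofReal, abs_of_pos (by positivity)]
      calc (2 : ℝ) ^ (k : ℕ) * ‖T (v i)‖ ≤ 2 ^ (k : ℕ) * 2⁻¹ ^ (k : ℕ) := by gcongr
        _ = 1 := by rw [← mul_pow]; norm_num
  have hY (k) : IsContraction (Y k) :=
    isContraction_of_orthogonal (fun i : {i // ℓ i = k} => v i)
      (fun i j hij => v.inner_eq_zero fun h => hij (Subtype.ext h)) fun i => (v.norm_eq_one _).le
  refine ⟨fun k => Fintype.card {i // ℓ i = k}, fun k => X k * ((Y k).map star).transpose,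
    fun k => (Fintype.card_subtype_le _).trans_eq (Fintype.card_fin N),
    fun k => (hX k).factorsThrough_card (hY k).map_star, ?_, ?_⟩
  · ext a b
    rw [hentry, Matrix.sum_apply, ← Fintype.sum_fiberwise ℓ]
    refine Finset.sum_congr rfl fun k _ => ?_
    rw [Matrix.smul_apply]
    change _ = _ • (X k * ((Y k).map star).transpose) a b
    rw [Matrix.mul_apply, Finset.smul_sum]
    refine Finset.sum_congr rfl fun i _ => ?_
    simp only [X, Y, Matrix.of_apply, Matrix.transpose_apply, Matrix.map_apply, PiLp.smul_apply,
      smul_eq_mul]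
    rw [← mul_assoc, ← mul_assoc, ← RCLike.ofReal_mul, ← mul_pow]
    norm_num
  -- Cauchy-Schwarz over the `L + 1` levels: this is the source of the logarithm.
  · refine Real.le_sqrt_of_sq_le (sq_sum_le_card_mul_sum_sq.trans ?_)
    rw [Finset.card_univ, Fintype.card_fin, mul_comm]
    push_cast
    gcongr
    calc ∑ k : Fin (L + 1), ((2⁻¹ : ℝ) ^ (k : ℕ) * √(Fintype.card {i // ℓ i = k})) ^ 2
        = ∑ k : Fin (L + 1), ∑ i : {i // ℓ i = k}, ((2⁻¹ : ℝ) ^ lev i) ^ 2 := by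
          refine Finset.sum_congr rfl fun k _ => ?_
          have (i : {i // ℓ i = k}) : lev i = k := congrArg Fin.val i.2
          simp only [this]
          rw [mul_pow, Real.sq_sqrt (Nat.cast_nonneg _), Finset.sum_const, nsmul_eq_mul,
            Finset.card_univ, mul_comm]
      _ = ∑ i, ((2⁻¹ : ℝ) ^ lev i) ^ 2 :=
          Fintype.sum_fiberwise ℓ fun i => ((2⁻¹ : ℝ) ^ lev i) ^ 2
      _ ≤ ∑ i, (4 * ‖T (v i)‖ ^ 2 + (N : ℝ)⁻¹) := Finset.sum_le_sum fun i _ => hlev' i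
      _ ≤ 5 := by
          rw [Finset.sum_add_distrib, ← Finset.mul_sum, Finset.sum_const, Finset.card_univ,
            Fintype.card_fin, nsmul_eq_mul]
          have := mul_inv_le_one (a := (N : ℝ))
          linarith

theorem signForm_sum (ξ η : (Fin d → Fin N) → ℤˣ) {κ : Type*} [Fintype κ] (c : κ → 𝕜)
    (B : Fin d → κ → Matrix (Fin N) (Fin N) 𝕜) :
    signForm ξ η (fun j => ∑ k, c k • B j k) =
      ∑ f : Fin d → κ, (∏ j, c (f j)) * signForm ξ η fun j => B j (f j) := by
  classical
  have (p q : Fin d → Fin N) : tensorMatrix (fun j => ∑ k, c k • B j k) p q =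
      ∑ f : Fin d → κ, (∏ j, c (f j)) * tensorMatrix (fun j => B j (f j)) p q := by
    simp only [tensorMatrix, Matrix.sum_apply, Matrix.smul_apply, smul_eq_mul,
      Finset.prod_univ_sum, Fintype.piFinset_univ, Finset.prod_mul_distrib]
  simp only [signForm, this, Finset.mul_sum]
  rw [Finset.sum_congr rfl fun p _ => Finset.sum_comm, Finset.sum_comm]
  refine Finset.sum_congr rfl fun f _ => Finset.sum_congr rfl fun p _ =>
    Finset.sum_congr rfl fun q _ => ?_
  ring

variable (𝕜) in
theorem exists_signs_of_sum_norm_sq_le_one (hN : 2 ≤ N) :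
    ∃ ξ η : (Fin d → Fin N) → ℤˣ, ∀ A : Fin d → Matrix (Fin N) (Fin N) 𝕜,
      (∀ j, ∑ a, ∑ b, ‖A j a b‖ ^ 2 ≤ 1) →
        ‖signForm ξ η A‖ ≤ signConst d * N * √(20 * Real.log N) ^ d := by
  obtain ⟨ξ, η, h⟩ := exists_signs 𝕜 N (by omega)
  refine ⟨ξ, η, fun A hA => ?_⟩
  set L := Nat.log 2 N
  have hL1 : 1 ≤ L := Nat.log_pos (by norm_num) hN
  have hL : N ≤ 4 ^ L := by
    calc N ≤ 2 ^ (L + 1) := (Nat.lt_pow_succ_log_self (by norm_num) N).le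
      _ ≤ 2 ^ (2 * L) := Nat.pow_le_pow_right (by norm_num) (by omega)
      _ = 4 ^ L := by rw [pow_mul]; norm_num
  -- As `L ≥ 1` and `log 2 > 1 / 2`, `5 (L + 1) ≤ 10 L ≤ 20 L log 2`.
  have hlog : 5 * ((L : ℝ) + 1) ≤ 20 * Real.log N := by
    have h1 : (L : ℝ) * Real.log 2 ≤ Real.log N := by
      rw [← Real.log_pow]
      exact Real.log_le_log (by positivity) (by exact_mod_cast Nat.pow_log_le_self 2 (by omega))
    have h2 := Real.log_two_gt_d9
    have h3 : (1 : ℝ) ≤ L := by exact_mod_cast hL1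
    nlinarith
  choose r B hrN hB hAB hsum using fun j => exists_dyadic_decomposition (A j) (hA j) L hL
  rw [funext hAB, signForm_sum]
  have hconst := signConst_nonneg d
  calc _ ≤ ∑ f : Fin d → Fin (L + 1), (∏ j, (2⁻¹ : ℝ) ^ (f j : ℕ)) *
        (signConst d * (N * √(∏ j, (r j (f j) : ℝ)))) := by
        refine (norm_sum_le _ _).trans (Finset.sum_le_sum fun f _ => ?_)
        rw [norm_mul, norm_prod]
        refine mul_le_mul (le_of_eq ?_) (h (fun j => r j (f j)) (fun j => hrN j _) _
          fun j => hB j _) (norm_nonneg _) (Finset.prod_nonneg fun j _ => by positivity)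
        refine Finset.prod_congr rfl fun j _ => ?_
        rw [RCLike.norm_ofReal, abs_of_pos (by positivity)]
    _ = signConst d * N * ∏ j, ∑ k : Fin (L + 1), (2⁻¹ : ℝ) ^ (k : ℕ) * √(r j k) := by
        rw [Finset.prod_univ_sum, Fintype.piFinset_univ, Finset.mul_sum]
        refine Finset.sum_congr rfl fun f _ => ?_
        rw [Real.sqrt_prod _ fun j _ => Nat.cast_nonneg _, Finset.prod_mul_distrib]
        ring
    _ ≤ signConst d * N * ∏ _j : Fin d, √(20 * Real.log N) := by
        gcongr with j
        exact (hsum j).trans (Real.sqrt_le_sqrt hlog)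
    _ = _ := by rw [Finset.prod_const, Finset.card_univ, Fintype.card_fin]

end Levels

/-! ### Coordinates -/

section Coordinates

variable {𝕜 : Type*} [RCLike 𝕜]

theorem sum_norm_sq_functional_orthonormal_le {E ι : Type*} [NormedAddCommGroup E]
    [InnerProductSpace 𝕜 E] [FiniteDimensional 𝕜 E] [Fintype ι] {w : ι → E} (hw : Orthonormal 𝕜 w)
    (u : E →L[𝕜] 𝕜) (hu : ‖u‖ ≤ 1) : ∑ i, ‖u (w i)‖ ^ 2 ≤ 1 := by
  have : CompleteSpace E := FiniteDimensional.complete 𝕜 E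
  let y := (InnerProductSpace.toDual 𝕜 E).symm u
  have hy : ‖y‖ ≤ 1 := by simpa [y] using hu
  have h := hw.sum_inner_products_le (x := y) (s := Finset.univ)
  refine (le_of_eq ?_).trans (h.trans (pow_le_one₀ (norm_nonneg _) hy))
  refine Finset.sum_congr rfl fun i _ => ?_
  rw [norm_inner_symm, InnerProductSpace.toDual_symm_apply]

/-- A functional of norm at most one that attains the norm of a vector given by its coordinates in
an orthonormal system. -/
theorem exists_functional_orthonormal {E ι : Type*} [NormedAddCommGroup E]
    [InnerProductSpace 𝕜 E] [Fintype ι] {w : ι → E} (hw : Orthonormal 𝕜 w)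
    (x : ι → 𝕜) : ∃ u : E →L[𝕜] 𝕜, ‖u‖ ≤ 1 ∧
      ∀ i, u (w i) = (((√(∑ i, ‖x i‖ ^ 2))⁻¹ : ℝ) : 𝕜) * star (x i) := by
  classical
  set ρ : ℝ := √(∑ i, ‖x i‖ ^ 2)
  let z : E := ((ρ⁻¹ : ℝ) : 𝕜) • ∑ i, x i • w i
  refine ⟨innerSL 𝕜 z, ?_, fun i => ?_⟩
  · have h := norm_sq_sum_smul_of_orthogonal w (fun i j hij => hw.2 hij) x
    simp only [hw.1, one_pow, mul_one] at h
    have h' : ‖∑ i, x i • w i‖ = ρ := by rw [← Real.sqrt_sq (norm_nonneg (∑ i, x i • w i)), h]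
    rw [innerSL_apply_norm, norm_smul, RCLike.norm_ofReal, h', abs_of_nonneg (by positivity)]
    -- Covers `ρ = 0` as well: the inverse is then 0 and so is the functional.
    exact inv_mul_le_one
  · rw [innerSL_apply_apply, inner_smul_left, hw.inner_left_fintype]
    simp

variable {ι : Type*} [Fintype ι] {H K : ι → Type*}
  [∀ j, NormedAddCommGroup (H j)] [∀ j, InnerProductSpace 𝕜 (H j)]
  [∀ j, FiniteDimensional 𝕜 (H j)]
  [∀ j, NormedAddCommGroup (K j)] [∀ j, InnerProductSpace 𝕜 (K j)]
  [∀ j, FiniteDimensional 𝕜 (K j)]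
  {α β : ι → Type*} [∀ j, Fintype (α j)] [∀ j, Fintype (β j)]
  (b : ∀ j, OrthonormalBasis (α j) 𝕜 (H j)) (c : ∀ j, OrthonormalBasis (β j) 𝕜 (K j))

theorem HilbertTensor.orthonormal_tprod :
    Orthonormal 𝕜 fun p : ∀ j, α j => HilbertTensor.tprod 𝕜 fun j => b j (p j) := by
  classical
  rw [orthonormal_iff_ite]
  intro p q
  rw [HilbertTensor.inner_tprod]
  split_ifs with h
  · subst h
    refine Finset.prod_eq_one fun j _ => ?_
    rw [inner_self_eq_norm_sq_to_K, (b j).norm_eq_one]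
    simp
  · obtain ⟨j, hj⟩ := Function.ne_iff.mp h
    exact Finset.prod_eq_zero (Finset.mem_univ j) ((b j).inner_eq_zero hj)

/-- The tensor with given coordinates in the basis of the `⨂ j, b j p ⊗ c j q`. -/
noncomputable def ofCoords [DecidableEq ι] (T : (∀ j, α j × β j) → 𝕜) :
    InjectiveTensor 𝕜 fun j => H j ⊗[𝕜] K j :=
  (InjectiveTensor.equiv 𝕜 fun j => H j ⊗[𝕜] K j).symm
    (∑ s, T s • PiTensorProduct.tprod 𝕜 fun j => b j (s j).1 ⊗ₜ[𝕜] c j (s j).2)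

variable [DecidableEq ι]

omit [∀ j, FiniteDimensional 𝕜 (H j)] [∀ j, FiniteDimensional 𝕜 (K j)] in
theorem ofCoords_surjective (t : InjectiveTensor 𝕜 fun j => H j ⊗[𝕜] K j) :
    ∃ T, ofCoords b c T = t := by
  let B := Basis.piTensorProduct fun j => ((b j).tensorProduct (c j)).toBasis
  refine ⟨B.repr (InjectiveTensor.equiv 𝕜 (fun j => H j ⊗[𝕜] K j) t), ?_⟩
  rw [ofCoords, LinearEquiv.symm_apply_eq]
  conv_rhs => rw [← B.sum_repr (InjectiveTensor.equiv 𝕜 (fun j => H j ⊗[𝕜] K j) t)]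
  refine Finset.sum_congr rfl fun s _ => ?_
  rw [Basis.piTensorProduct_apply]
  congr 2
  funext j
  rw [OrthonormalBasis.coe_toBasis, OrthonormalBasis.tensorProduct_apply']

omit [∀ j, FiniteDimensional 𝕜 (H j)] [∀ j, FiniteDimensional 𝕜 (K j)] in
theorem tensorFunctional_ofCoords (T : (∀ j, α j × β j) → 𝕜)
    (f : ∀ j, (H j ⊗[𝕜] K j) →L[𝕜] 𝕜) :
    tensorFunctional f (InjectiveTensor.equiv 𝕜 _ (ofCoords b c T)) =
      ∑ s, T s * ∏ j, f j (b j (s j).1 ⊗ₜ[𝕜] c j (s j).2) := by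
  simp [ofCoords]

theorem functional_identification_ofCoords (T : (∀ j, α j × β j) → 𝕜)
    (u : HilbertTensor 𝕜 H →L[𝕜] 𝕜) (v : HilbertTensor 𝕜 K →L[𝕜] 𝕜) :
    InjectiveTensor₂.functional u v (InjectiveTensor₂.equiv 𝕜 _ _
        (identification 𝕜 H K (ofCoords b c T))) =
      ∑ s, T s * (u (HilbertTensor.tprod 𝕜 fun j => b j (s j).1) *
        v (HilbertTensor.tprod 𝕜 fun j => c j (s j).2)) := by
  simp only [ofCoords, map_sum, map_smul, smul_eq_mul]
  refine Finset.sum_congr rfl fun s _ => ?_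
  rw [identification_tprod, LinearEquiv.apply_symm_apply, InjectiveTensor₂.functional_tmul]

/-- An injective norm on Hilbert spaces is at most the Hilbertian one: by Bessel, the coordinates of
`u ⊗ v` have ℓ² norm at most one, and Cauchy-Schwarz applies. -/
theorem norm_identification_ofCoords_le (T : (∀ j, α j × β j) → 𝕜) :
    ‖identification 𝕜 H K (ofCoords b c T)‖ ≤ √(∑ s, ‖T s‖ ^ 2) := by
  refine ciSup_le fun f => Real.le_sqrt_of_sq_le ?_
  rw [functional_identification_ofCoords]
  refine (norm_sum_mul_sq_le _ _).trans (mul_le_of_le_one_right (by positivity) ?_)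
  have h1 := sum_norm_sq_functional_orthonormal_le (HilbertTensor.orthonormal_tprod b) _ f.2.1
  have h2 := sum_norm_sq_functional_orthonormal_le (HilbertTensor.orthonormal_tprod c) _ f.2.2
  refine (le_of_eq ?_).trans (mul_le_one₀ h1 (by positivity) h2)
  rw [Finset.sum_mul_sum, ← Fintype.sum_prod_type', ← (Equiv.arrowProdEquivProdArrow _ _ _).sum_comp]
  refine Finset.sum_congr rfl fun s _ => ?_
  rw [norm_mul, mul_pow]
  rfl

omit [∀ j, FiniteDimensional 𝕜 (H j)] [∀ j, FiniteDimensional 𝕜 (K j)] in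
theorem sum_norm_sq_slice_le (T : (∀ j, α j × β j) → 𝕜) (s₀ : ∀ j, α j × β j) (j₀ : ι) :
    ∑ k, ‖T (Function.update s₀ j₀ k)‖ ^ 2 ≤ ‖ofCoords b c T‖ ^ 2 := by
  classical
  set ρ : ℝ := √(∑ k, ‖T (Function.update s₀ j₀ k)‖ ^ 2) with hρ
  have hρ2 : ρ ^ 2 = ∑ k, ‖T (Function.update s₀ j₀ k)‖ ^ 2 := Real.sq_sqrt (by positivity)
  rw [← hρ2]
  suffices h : ρ ≤ ‖ofCoords b c T‖ by gcongr
  let g (j) := (b j).tensorProduct (c j)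
  have hg (j) (i) : b j i.1 ⊗ₜ[𝕜] c j i.2 = g j i := ((b j).tensorProduct_apply' (c j) i).symm
  obtain ⟨φ, hφ1, hφ⟩ := exists_functional_orthonormal (g j₀).orthonormal
    fun k => T (Function.update s₀ j₀ k)
  -- For `j ≠ j₀` the coordinate functional at `s₀ j` freezes that index; at `j₀`, `φ` attains the
  -- ℓ² norm of the slice.
  let F : ∀ j, (H j ⊗[𝕜] K j) →L[𝕜] 𝕜 :=
    Function.update (fun j => innerSL 𝕜 (g j (s₀ j))) j₀ φ
  have hF1 (j) : ‖F j‖ ≤ 1 := by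
    by_cases hj : j = j₀
    · subst hj
      simpa [F] using hφ1
    · simp only [F, Function.update_of_ne hj, innerSL_apply_norm]
      exact ((g j).norm_eq_one _).le
  refine le_trans (le_of_eq ?_) (InjectiveTensor.le_norm _ (ofCoords b c T) ⟨F, hF1⟩)
  rw [tensorFunctional_ofCoords]
  have hval : ∑ s, T s * ∏ j, F j (b j (s j).1 ⊗ₜ[𝕜] c j (s j).2) =
      ∑ k, T (Function.update s₀ j₀ k) * φ (g j₀ k) := by
    symm
    refine Finset.sum_of_injOn (fun k => Function.update s₀ j₀ k)
      (Function.update_injective s₀ j₀).injOn (by simp) (fun s _ hs => ?_) fun k _ => ?_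
    · obtain ⟨j, hj, hjs⟩ : ∃ j, j ≠ j₀ ∧ s j ≠ s₀ j := by
        by_contra! hcon
        refine hs ⟨s j₀, by simp, ?_⟩
        funext j
        by_cases hj : j = j₀
        · subst hj
          simp
        · simp [hj, hcon j hj]
      rw [Finset.prod_eq_zero (Finset.mem_univ j), mul_zero]
      rw [hg]
      simp only [F, Function.update_of_ne hj, innerSL_apply_apply]
      exact (g j).inner_eq_zero hjs.symm
    · rw [← Finset.mul_prod_erase _ _ (Finset.mem_univ j₀), Finset.prod_eq_one, mul_one]
      · simp [F, hg]
      · intro j hj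
        have hj := Finset.ne_of_mem_erase hj
        rw [hg]
        simp only [F, Function.update_of_ne hj, innerSL_apply_apply]
        rw [inner_self_eq_norm_sq_to_K, (g j).norm_eq_one]
        simp
  rw [hval]
  simp only [hφ]
  rw [← hρ]
  have : ∑ k, T (Function.update s₀ j₀ k) * (((ρ⁻¹ : ℝ) : 𝕜) * star (T (Function.update s₀ j₀ k))) =
      ((ρ⁻¹ * ρ ^ 2 : ℝ) : 𝕜) := by
    rw [hρ2]
    push_cast
    rw [Finset.mul_sum]
    refine Finset.sum_congr rfl fun k _ => ?_
    rw [← RCLike.mul_conj, mul_left_comm]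
    rfl
  rw [this, RCLike.norm_ofReal, abs_of_nonneg (by positivity)]
  have hρ0 : 0 ≤ ρ := Real.sqrt_nonneg _
  rcases hρ0.eq_or_lt with h | h
  · rw [← h]
    simp
  · field_simp

theorem norm_identification_le (j₀ : ι) :
    ‖identification 𝕜 H K‖ ≤ ∏ j ∈ Finset.univ.erase j₀,
      √((Module.finrank 𝕜 (H j) : ℝ) * Module.finrank 𝕜 (K j)) := by
  refine ContinuousLinearMap.opNorm_le_bound _ (by positivity) fun t => ?_
  let b := fun j => stdOrthonormalBasis 𝕜 (H j)
  let c := fun j => stdOrthonormalBasis 𝕜 (K j)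
  obtain ⟨T, rfl⟩ := ofCoords_surjective b c t
  refine (norm_identification_ofCoords_le b c T).trans (Real.sqrt_le_iff.mpr ⟨by positivity, ?_⟩)
  rw [mul_pow, ← Finset.prod_pow]
  simp only [Real.sq_sqrt (mul_nonneg (Nat.cast_nonneg (α := ℝ) _) (Nat.cast_nonneg _))]
  let γ := fun j => Fin (Module.finrank 𝕜 (H j)) × Fin (Module.finrank 𝕜 (K j))
  let e := Equiv.piSplitAt j₀ γ
  have hslice (s : ∀ j : {j // j ≠ j₀}, γ j) :
      ∑ k, ‖T (e.symm (k, s))‖ ^ 2 ≤ ‖ofCoords b c T‖ ^ 2 := by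
    -- The slice estimate takes a full index as base point, whose value at `j₀` is irrelevant but
    -- must exist.
    by_cases hne : Nonempty (γ j₀)
    · obtain ⟨k₀⟩ := hne
      refine (le_of_eq ?_).trans (sum_norm_sq_slice_le b c T (e.symm (k₀, s)) j₀)
      refine Finset.sum_congr rfl fun k _ => ?_
      congr 3
      funext j
      by_cases hj : j = j₀
      · subst hj
        simp [e, Equiv.piSplitAt]
      · simp [e, Equiv.piSplitAt, hj]
    · have : IsEmpty (γ j₀) := not_nonempty_iff.mp hne
      rw [Finset.univ_eq_empty, Finset.sum_empty]
      positivity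
  calc ∑ s, ‖T s‖ ^ 2 = ∑ s : ∀ j : {j // j ≠ j₀}, γ j, ∑ k, ‖T (e.symm (k, s))‖ ^ 2 := by
        rw [← e.symm.sum_comp, Fintype.sum_prod_type, Finset.sum_comm]
    _ ≤ ∑ _s : ∀ j : {j // j ≠ j₀}, γ j, ‖ofCoords b c T‖ ^ 2 :=
        Finset.sum_le_sum fun s _ => hslice s
    _ = _ := by
        have hp : ∏ j ∈ Finset.univ.erase j₀,
            (Module.finrank 𝕜 (H j) : ℝ) * Module.finrank 𝕜 (K j) =
            ∏ j : {j // j ≠ j₀}, (Module.finrank 𝕜 (H j) : ℝ) * Module.finrank 𝕜 (K j) :=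
          Finset.prod_subtype _ (by simp) _
        rw [Finset.sum_const, nsmul_eq_mul, Finset.card_univ, Fintype.card_pi, hp]
        simp [γ]

end Coordinates

/-! ### The lower bound from the sign tensor -/

section LowerBound

variable {𝕜 : Type*} [RCLike 𝕜] {d N : ℕ} {H K : Fin d → Type*}
  [∀ j, NormedAddCommGroup (H j)] [∀ j, InnerProductSpace 𝕜 (H j)]
  [∀ j, FiniteDimensional 𝕜 (H j)]
  [∀ j, NormedAddCommGroup (K j)] [∀ j, InnerProductSpace 𝕜 (K j)]
  [∀ j, FiniteDimensional 𝕜 (K j)]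

theorem norm_intUnit_cast (s : ℤˣ) : ‖((s : ℤ) : 𝕜)‖ = 1 := by
  rcases Int.units_eq_one_or s with rfl | rfl <;> simp

theorem pow_le_norm_identification_mul (hN : 2 ≤ N)
    (hH : ∀ j, Module.finrank 𝕜 (H j) = N) (hK : ∀ j, Module.finrank 𝕜 (K j) = N) :
    (N : ℝ) ^ d ≤ ‖identification 𝕜 H K‖ * (signConst d * N * √(20 * Real.log N) ^ d) := by
  obtain ⟨ξ, η, h⟩ := exists_signs_of_sum_norm_sq_le_one 𝕜 hN
  let b : ∀ j, OrthonormalBasis (Fin N) 𝕜 (H j) := fun j =>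
    (stdOrthonormalBasis 𝕜 (H j)).reindex (finCongr (hH j))
  let c : ∀ j, OrthonormalBasis (Fin N) 𝕜 (K j) := fun j =>
    (stdOrthonormalBasis 𝕜 (K j)).reindex (finCongr (hK j))
  let e := Equiv.arrowProdEquivProdArrow (Fin d) (fun _ => Fin N) (fun _ => Fin N)
  let T : (Fin d → Fin N × Fin N) → 𝕜 := fun s =>
    ((ξ fun j => (s j).1 : ℤ) : 𝕜) * ((η fun j => (s j).2 : ℤ) : 𝕜)
  have hnorm : ‖ofCoords b c T‖ ≤ signConst d * N * √(20 * Real.log N) ^ d := by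
    refine ciSup_le fun f => ?_
    -- A functional of norm at most one on `H j ⊗ K j` is a matrix of Hilbert-Schmidt norm at most
    -- one, so the injective norm of the sign tensor is bounded by the values of `signForm`.
    let A : Fin d → Matrix (Fin N) (Fin N) 𝕜 := fun j => Matrix.of fun p q =>
      f.1 j (b j p ⊗ₜ[𝕜] c j q)
    have hA (j) : ∑ p, ∑ q, ‖A j p q‖ ^ 2 ≤ 1 := by
      have := sum_norm_sq_functional_orthonormal_le ((b j).tensorProduct (c j)).orthonormal
        (f.1 j) (f.2 j)
      rw [Fintype.sum_prod_type] at this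
      simpa [A] using this
    refine (le_of_eq ?_).trans (h A hA)
    rw [tensorFunctional_ofCoords, signForm, ← Fintype.sum_prod_type', ← e.sum_comp]
    rfl
  have hcard : ∑ p : Fin d → Fin N, (1 : ℝ) = (N : ℝ) ^ d := by simp
  have hnormsq (ε : (Fin d → Fin N) → ℤˣ) :
      √(∑ p, ‖((ε p : ℤ) : 𝕜)‖ ^ 2) = √((N : ℝ) ^ d) := by
    simp only [norm_intUnit_cast, one_pow, hcard]
  obtain ⟨u, hu1, hu⟩ := exists_functional_orthonormal (HilbertTensor.orthonormal_tprod b)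
    fun p => ((ξ p : ℤ) : 𝕜)
  obtain ⟨v, hv1, hv⟩ := exists_functional_orthonormal (HilbertTensor.orthonormal_tprod c)
    fun p => ((η p : ℤ) : 𝕜)
  have hlow : (N : ℝ) ^ d ≤ ‖identification 𝕜 H K (ofCoords b c T)‖ := by
    refine le_trans (le_of_eq ?_) (InjectiveTensor₂.le_norm _ _
      (identification 𝕜 H K (ofCoords b c T)) ⟨(u, v), hu1, hv1⟩)
    rw [functional_identification_ofCoords]
    have hpos : (0 : ℝ) < (N : ℝ) ^ d := by positivity
    -- The normalized conjugate signs give each of the `N ^ (2 d)` terms the same value `N ^ (-d)`,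
    -- for a total of `N ^ d`.
    have hterm (s : Fin d → Fin N × Fin N) :
        T s * (u (HilbertTensor.tprod 𝕜 fun j => b j (s j).1) *
          v (HilbertTensor.tprod 𝕜 fun j => c j (s j).2)) = ((((N : ℝ) ^ d)⁻¹ : ℝ) : 𝕜) := by
      rw [hu fun j => (s j).1, hv fun j => (s j).2, hnormsq, hnormsq]
      have hone (s : ℤˣ) : ((s : ℤ) : 𝕜) * star ((s : ℤ) : 𝕜) = 1 := by
        rcases Int.units_eq_one_or s with rfl | rfl <;> simp
      have hs : ((((N : ℝ) ^ d)⁻¹ : ℝ) : 𝕜) =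
          (((√((N : ℝ) ^ d))⁻¹ : ℝ) : 𝕜) * (((√((N : ℝ) ^ d))⁻¹ : ℝ) : 𝕜) := by
        rw [← RCLike.ofReal_mul, ← mul_inv, Real.mul_self_sqrt hpos.le]
      rw [hs]
      simp only [T]
      linear_combination (((√((N : ℝ) ^ d))⁻¹ : ℝ) : 𝕜) * (((√((N : ℝ) ^ d))⁻¹ : ℝ) : 𝕜) *
        (((η fun j => (s j).2 : ℤ) : 𝕜) * star ((η fun j => (s j).2 : ℤ) : 𝕜)) *
          hone (ξ fun j => (s j).1) +
        (((√((N : ℝ) ^ d))⁻¹ : ℝ) : 𝕜) * (((√((N : ℝ) ^ d))⁻¹ : ℝ) : 𝕜) *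
          hone (η fun j => (s j).2)
    simp only [hterm]
    rw [Finset.sum_const, Finset.card_univ, Fintype.card_fun, Fintype.card_prod, Fintype.card_fin,
      Fintype.card_fin, nsmul_eq_mul, norm_mul, RCLike.norm_natCast, RCLike.norm_ofReal,
      abs_of_pos (by positivity)]
    push_cast
    rw [mul_pow]
    field_simp
  calc (N : ℝ) ^ d ≤ ‖identification 𝕜 H K (ofCoords b c T)‖ := hlow
    _ ≤ ‖identification 𝕜 H K‖ * ‖ofCoords b c T‖ := ContinuousLinearMap.le_opNorm _ _
    _ ≤ _ := by gcongr

end LowerBound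

end TensorNorms

theorem mainTheorem3 {𝕜 : Type w} [RCLike 𝕜] (d : ℕ) (hd : 1 ≤ d) :
    (∀ (H : Fin d → Type u) (K : Fin d → Type v)
        [∀ j, NormedAddCommGroup (H j)] [∀ j, InnerProductSpace 𝕜 (H j)]
        [∀ j, FiniteDimensional 𝕜 (H j)]
        [∀ j, NormedAddCommGroup (K j)] [∀ j, InnerProductSpace 𝕜 (K j)]
        [∀ j, FiniteDimensional 𝕜 (K j)] (j₀ : Fin d),
        ‖TensorNorms.identification 𝕜 H K‖ ≤
          ∏ j ∈ Finset.univ.erase j₀,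
            Real.sqrt ((Module.finrank 𝕜 (H j) : ℝ) * (Module.finrank 𝕜 (K j) : ℝ))) ∧
    ∃ c : ℝ, 0 < c ∧ ∀ (N : ℕ), 2 ≤ N →
      ∀ (H : Fin d → Type u) (K : Fin d → Type v)
        [∀ j, NormedAddCommGroup (H j)] [∀ j, InnerProductSpace 𝕜 (H j)]
        [∀ j, FiniteDimensional 𝕜 (H j)]
        [∀ j, NormedAddCommGroup (K j)] [∀ j, InnerProductSpace 𝕜 (K j)]
        [∀ j, FiniteDimensional 𝕜 (K j)],
        (∀ j, Module.finrank 𝕜 (H j) = N) → (∀ j, Module.finrank 𝕜 (K j) = N) →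
          c * (N : ℝ) ^ (d - 1) * (Real.log N) ^ (-((d : ℝ) / 2)) ≤
              ‖TensorNorms.identification 𝕜 H K‖ ∧
            ‖TensorNorms.identification 𝕜 H K‖ ≤ (N : ℝ) ^ (d - 1) := by
  refine ⟨fun H K _ _ _ _ _ _ j₀ => TensorNorms.norm_identification_le j₀,
    (TensorNorms.signConst d * √20 ^ d)⁻¹, ?_, fun N hN H K _ _ _ _ _ _ hH hK => ⟨?_, ?_⟩⟩
  · rw [TensorNorms.signConst]
    positivity
  · have h := TensorNorms.pow_le_norm_identification_mul hN hH hK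
    have hsign : 0 < TensorNorms.signConst d := by
      rw [TensorNorms.signConst]
      positivity
    have hlog : 0 < Real.log N := Real.log_pos (by exact_mod_cast hN)
    have hN0 : (0 : ℝ) < N := by positivity
    -- Removes the truncated subtraction in `d - 1`; one factor `N` then cancels from `N ^ (k + 1)`.
    obtain ⟨k, rfl⟩ : ∃ k, d = k + 1 := ⟨d - 1, by omega⟩
    have hrpow : Real.log N ^ (-(((k + 1 : ℕ) : ℝ) / 2)) = (√(Real.log N) ^ (k + 1))⁻¹ := by
      rw [Real.rpow_neg hlog.le, Real.sqrt_eq_rpow, ← Real.rpow_natCast, ← Real.rpow_mul hlog.le]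
      congr 2
      ring
    rw [hrpow, Real.sqrt_mul (by norm_num), mul_pow, pow_succ (N : ℝ) k] at *
    rw [Nat.add_sub_cancel, mul_assoc, ← div_eq_mul_inv, inv_mul_le_iff₀ (by positivity),
      div_le_iff₀ (by positivity)]
    refine le_of_mul_le_mul_right (h.trans_eq ?_) hN0
    ring
  · refine (TensorNorms.norm_identification_le ⟨0, hd⟩).trans_eq ?_
    simp only [hH, hK, Real.sqrt_mul_self (Nat.cast_nonneg N)]
    rw [Finset.prod_const, Finset.card_erase_of_mem (Finset.mem_univ _), Finset.card_univ,
      Fintype.card_fin]
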